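/- Let $(\Omega,d)$ be a connected metric space and let $\mu$ be a $\sigma$-finite Borel measure on $\Omega$ that is finite on compact sets and resonant (for all a.e. finite measurable $f,g$ one has $\int_0^\infty f^*_\mu g^*_\mu\,ds=\sup\int_\Omega|f\tilde g|\,d\mu$, the supremum being over all $\tilde g$ equimeasurable with $g$; here $f^*_\mu(s)=\inf\{t\ge 0:\mu\{|f|>t\}\le s\}$). Put $$|\nabla f(x)|=\limsup_{y\to x}\frac{|f(x)-f(y)|}{d(x,y)},\qquad \mu^+(A)=\liminf_{h\to0^+}\frac{\mu(\{x:d(x,A)<h\})-\mu(A)}{h},\qquad I(t)=\inf\{\mu^+(A):A\text{ Borel},\ \mu(A)=t\}.$$ Assume that the isoperimetric profile $I:[0,\mu(\Omega))\to[0,\infty)$ is concave, continuous and zero at zero, and moreover symmetric around $\mu(\Omega)/2$ if $\mu(\Omega)<\infty$, and increasing if $\mu(\Omega)=\infty$. Let $X$ be a rearrangement invariant Banach function space on $\Omega$ (with the Fatou property), and let $\bar X$ be its representation on $(0,\mu(\Omega))$ with Lebesgue measure, determined by $\|f\|_X=\|f^*_\mu\|_{\bar X}$. Assume that the isoperimetric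 Hardy operator $$\tilde Q_I h(t)=\frac{I(t)}{t}\int_t^{\mu(\Omega)/2}h(s)\,\frac{ds}{I(s)}$$ (read as $0$ for $t\ge\mu(\Omega)/2$) is bounded on $\bar X$. Let $w:\Omega\to[0,\infty)$ be an isoperimetric weight, i.e. $w$ is locally integrable (integrable on compact sets), $w>0$ a.e., and there is a constant $C(w)$ such that $$\Phi(\mu\{w\le r\})\le C(w)\,r\quad\text{for all }r>0,\qquad \Phi(t)=\frac{\min\{t,\mu(\Omega)/2\}}{I(\min\{t,\mu(\Omega)/2\})},$$ where $0/0=0$, $a/0=\infty$ for $a>0$, and $\Phi(\infty)=\lim_{t\to\infty}\Phi(t)$ if $\mu(\Omega)=\infty$. Then there is a constant $C>0$, depending only on $w$ and $X$ (and the underlying space), such that for every $\alpha>0$ $$\|f\|_X\le rC\,\|\,|\nabla f|\,\|_X+r^{-\alpha}\,\|w^\alpha f\|_X\qquad\text{for all } r>0,$$ for all bounded Lipschitz functions $f:\Omega\to\mathbb R$ such that $0$ is a median of $f$ (i.e. $\mu\{f\ge0\}\ge\mu(\Omega)/2$ and $\mu\{f\le0\}\ge\mu(\Omega)/2$) or $\int_\Omega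 f\,d\mu=0$, if $\mu(\Omega)<\infty$; and for all Lipschitz functions $f$ with compact support, if $\mu(\Omega)=\infty$. (Norms may take the value $+\infty$.) -/

import Mathlib

open MeasureTheory Set Filter Topology
open scoped ENNReal NNReal

noncomputable section

/-! ### Geometry of a metric measure space -/

/-- The modulus of the gradient `|∇f(x)| = limsup_{y → x} |f(x) - f(y)| / d(x,y)`. -/
def gradModulus {Ω : Type*} [MetricSpace Ω] (f : Ω → ℝ) (x : Ω) : ℝ≥0∞ :=
  limsup (fun y => ENNReal.ofReal |f x - f y| / edist x y) (𝓝[≠] x)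

/-- The perimeter (Minkowski content) `μ⁺(A) = liminf_{h → 0+} (μ(A_h) - μ(A)) / h`, where
`A_h = {x : d(x, A) < h}`. -/
def perimeter {Ω : Type*} [MetricSpace Ω] [MeasurableSpace Ω] (μ : Measure Ω) (A : Set Ω) :
    ℝ≥0∞ :=
  liminf (fun h : ℝ => (μ (Metric.thickening h A) - μ A) / ENNReal.ofReal h) (𝓝[>] 0)

/-- The isoperimetric profile `I(t) = inf {μ⁺(A) : A Borel, μ(A) = t}`. -/
def isoProfile {Ω : Type*} [MetricSpace Ω] [MeasurableSpace Ω] (μ : Measure Ω) (t : ℝ≥0∞) :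
    ℝ≥0∞ :=
  ⨅ (A : Set Ω) (_ : MeasurableSet A) (_ : μ A = t), perimeter μ A

/-- The domain `[0, μ(Ω))` of the isoperimetric profile, as a set of real numbers. -/
def profileDomain {Ω : Type*} [MeasurableSpace Ω] (μ : Measure Ω) : Set ℝ :=
  {t | 0 ≤ t ∧ ENNReal.ofReal t < μ univ}

/-- The standing assumptions on the isoperimetric profile `I : [0, μ(Ω)) → ℝ₊`: it is (finite,)
concave, continuous and zero at zero; it is symmetric around `μ(Ω)/2` if `μ(Ω) < ∞`, and
increasing if `μ(Ω) = ∞`. -/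
structure AdmissibleProfile {Ω : Type*} [MetricSpace Ω] [MeasurableSpace Ω] (μ : Measure Ω) :
    Prop where
  finite : ∀ t ∈ profileDomain μ, isoProfile μ (ENNReal.ofReal t) < ∞
  concave : ConcaveOn ℝ (profileDomain μ) fun t => (isoProfile μ (ENNReal.ofReal t)).toReal
  continuous : ContinuousOn (fun t => (isoProfile μ (ENNReal.ofReal t)).toReal) (profileDomain μ)
  zero : isoProfile μ 0 = 0
  symmetric : μ univ < ∞ → ∀ t : ℝ≥0∞, 0 < t → t < μ univ →
    isoProfile μ t = isoProfile μ (μ univ - t)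
  increasing : μ univ = ∞ → ∀ s t : ℝ≥0∞, s ≤ t → t < ∞ → isoProfile μ s ≤ isoProfile μ t

/-- `m` is a median of `f`. -/
def IsMedian {Ω : Type*} [MeasurableSpace Ω] (μ : Measure Ω) (f : Ω → ℝ) (m : ℝ) : Prop :=
  μ univ / 2 ≤ μ {x | m ≤ f x} ∧ μ univ / 2 ≤ μ {x | f x ≤ m}

/-- The function `Φ(t) = min{t, μ(Ω)/2} / I(min{t, μ(Ω)/2})`, with values in `[0, ∞]`
(`0/0 = 0`, and `a/0 = ∞` for `a > 0`). Since `Φ` is non-decreasing, its value at `t = ∞`, which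
is only relevant when `μ(Ω) = ∞`, is its limit at `∞`. -/
def isoPhi {Ω : Type*} [MetricSpace Ω] [MeasurableSpace Ω] (μ : Measure Ω) (t : ℝ≥0∞) : ℝ≥0∞ :=
  open Classical in
  if t = ∞ then ⨆ (s : ℝ≥0∞) (_ : s < ∞), s / isoProfile μ s
  else min t (μ univ / 2) / isoProfile μ (min t (μ univ / 2))

/-- Isoperimetric weights: locally integrable functions `w : Ω → ℝ₊` with `w > 0` a.e. and
`Φ(μ{w ≤ r}) ≤ C r` for all `r > 0`. -/
structure IsIsoperimetricWeight {Ω : Type*} [MetricSpace Ω] [MeasurableSpace Ω] (μ : Measure Ω)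
    (w : Ω → ℝ) : Prop where
  aemeasurable : AEMeasurable w μ
  locally_integrable : ∀ K : Set Ω, IsCompact K → IntegrableOn w K μ
  nonneg : ∀ x, 0 ≤ w x
  pos : ∀ᵐ x ∂μ, 0 < w x
  growth : ∃ C : ℝ, 0 < C ∧ ∀ r : ℝ, 0 < r → isoPhi μ (μ {x | w x ≤ r}) ≤ ENNReal.ofReal (C * r)

/-! ### Rearrangement invariant spaces -/

/-- The decreasing rearrangement `f*(s) = inf {t ≥ 0 : μ{f > t} ≤ s}` of a function with values in
`[0, ∞]`. -/
def decRearr {α : Type*} [MeasurableSpace α] (μ : Measure α) (f : α → ℝ≥0∞) (s : ℝ) : ℝ≥0∞ :=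
  sInf {t : ℝ≥0∞ | μ {x | t < f x} ≤ ENNReal.ofReal s}

/-- Resonant measure spaces: for all a.e. finite measurable `f`, `g`, the integral `∫₀^∞ f* g*` is
the supremum of `∫ |f g'| dμ` over all `g'` with the same rearrangement as `g`. -/
def IsResonant {α : Type*} [MeasurableSpace α] (μ : Measure α) : Prop :=
  ∀ f g : α → ℝ≥0∞, AEMeasurable f μ → AEMeasurable g μ →
    (∀ᵐ x ∂μ, f x < ∞) → (∀ᵐ x ∂μ, g x < ∞) →
    ∫⁻ s in Ioi (0 : ℝ), decRearr μ f s * decRearr μ g s =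
      ⨆ (g' : α → ℝ≥0∞) (_ : AEMeasurable g' μ) (_ : decRearr μ g' = decRearr μ g),
        ∫⁻ x, f x * g' x ∂μ

/-- A rearrangement invariant Banach function space over `(α, μ)` (with the Fatou property), given
by its function norm `norm` on the measurable functions with values in `[0, ∞]`. The space itself
consists of the measurable `f : α → ℝ` with `norm |f| < ∞`, and `‖f‖ = norm |f|`. -/
structure RISpace {α : Type*} [MeasurableSpace α] (μ : Measure α) where
  norm : (α → ℝ≥0∞) → ℝ≥0∞
  norm_eq_zero_iff : ∀ f, AEMeasurable f μ → (norm f = 0 ↔ f =ᵐ[μ] 0)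
  norm_smul : ∀ (a : ℝ≥0) (f), AEMeasurable f μ → norm (fun x => a * f x) = a * norm f
  norm_add_le : ∀ f g, AEMeasurable f μ → AEMeasurable g μ →
    norm (fun x => f x + g x) ≤ norm f + norm g
  norm_mono : ∀ f g, AEMeasurable f μ → AEMeasurable g μ → f ≤ᵐ[μ] g → norm f ≤ norm g
  fatou : ∀ f : ℕ → α → ℝ≥0∞, (∀ n, AEMeasurable (f n) μ) →
    (∀ᵐ x ∂μ, Monotone fun n => f n x) → norm (fun x => ⨆ n, f n x) = ⨆ n, norm (f n)
  norm_indicator_lt_top : ∀ E : Set α, MeasurableSet E → μ E < ∞ →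
    norm (E.indicator fun _ => 1) < ∞
  lintegral_le : ∀ E : Set α, MeasurableSet E → μ E < ∞ →
    ∃ C : ℝ≥0, ∀ f, AEMeasurable f μ → ∫⁻ x in E, f x ∂μ ≤ C * norm f
  rearrangement_invariant : ∀ f g, AEMeasurable f μ → AEMeasurable g μ →
    decRearr μ f = decRearr μ g → norm f = norm g

/-- The norm `‖f‖_X` of a real-valued function. -/
def RISpace.normReal {α : Type*} [MeasurableSpace α] {μ : Measure α} (X : RISpace μ)
    (f : α → ℝ) : ℝ≥0∞ :=
  X.norm fun x => ENNReal.ofReal |f x|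

/-- Lebesgue measure on the interval `(0, m)`, where `0 ≤ m ≤ ∞`. -/
def lebesgueOn (m : ℝ≥0∞) : Measure ℝ :=
  volume.restrict {s : ℝ | 0 < s ∧ ENNReal.ofReal s < m}

/-- The norm of the representation space `X̄` of `X` on the interval `(0, μ(Ω))`. It is determined
by the requirement `‖f‖_X = ‖f*‖_X̄`: the norm of `h` is the common value of `‖f‖_X` for all `f`
on `Ω` that have the same rearrangement as `h`. -/
def RISpace.barNorm {α : Type*} [MeasurableSpace α] {μ : Measure α} (X : RISpace μ)
    (h : ℝ → ℝ≥0∞) : ℝ≥0∞ :=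
  ⨆ (f : α → ℝ≥0∞) (_ : AEMeasurable f μ) (_ : decRearr μ f = decRearr (lebesgueOn (μ univ)) h),
    X.norm f

/-- The isoperimetric Hardy operator `Q̃h(t) = (I(t)/t) ∫_t^{μ(Ω)/2} h(s) ds / I(s)` on non-negative
functions (the integral is over the empty set if `t ≥ μ(Ω)/2`). -/
def isoHardy {Ω : Type*} [MetricSpace Ω] [MeasurableSpace Ω] (μ : Measure Ω) (h : ℝ → ℝ≥0∞)
    (t : ℝ) : ℝ≥0∞ :=
  isoProfile μ (ENNReal.ofReal t) / ENNReal.ofReal t *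
    ∫⁻ s in {s : ℝ | t < s ∧ ENNReal.ofReal s < μ univ / 2}, h s / isoProfile μ (ENNReal.ofReal s)

/-- `Q̃` is bounded on `X̄`. Since the kernel of `Q̃` is non-negative, it suffices to consider
non-negative functions. -/
def IsoHardyBounded {Ω : Type*} [MetricSpace Ω] [MeasurableSpace Ω] {μ : Measure Ω}
    (X : RISpace μ) : Prop :=
  ∃ K : ℝ≥0, ∀ h : ℝ → ℝ≥0∞, AEMeasurable h (lebesgueOn (μ univ)) →
    X.barNorm (isoHardy μ h) ≤ K * X.barNorm h

end

/-! Put `W = {w ≤ r}`. Off `W` one has `1 ≤ (w/r)^α`, which produces the term `r^(-α) ‖w^α f‖`, and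
`Φ(μ W) ≤ C(w) r`. What remains is a local estimate `‖f 1_W‖ ≤ Θ Λ ‖|∇f|‖` whenever `Φ(μ W) ≤ Λ`,
with `Θ` independent of `W`, `f` and `α`.

Let `f` be positive on a set of measure at most `s₀ ≤ μ(Ω)/2`. The rearrangement of `f⁺ 1_W`
vanishes beyond `μ W`, and below it `t/I(t) ≤ Φ(μ W) ≤ Λ` because `t/I(t)` is non-decreasing. Hence
`(f⁺ 1_W)*(t) ≤ Λ f*(t) I(t)/t`, where `f*` is the rearrangement of `f⁺`, and it suffices to bound
`f*(t) I(t)/t` in norm by `|∇f|` (`IsUniform.norm_rearrangement_le_gradModulus`). The coarea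
inequality on the layer between the levels `f*(2σ)` and `f*(σ)`, `σ = s₀/2^(k+1)`, gives `(f*(σ) -
f*(2σ)) I(σ) ≤ ∫_layer |∇f|`, and the layer has measure at most `σ`. Averaging over disjoint layers
does not increase the norm, summing the drops bounds `f*(t) I(t)/t` by `Q̃` of the averages, and
`Q̃` is bounded.

If `0` is a median, or the support is compact and `μ(Ω) = ∞`, this applies to `f` and `-f`. If `∫ f
= 0`, a median `m` is subtracted; `|m|` is controlled by the same estimate on `W = Ω`, and `‖1_W‖`
is at most a multiple of `Λ`.

Functions on `(0, s₀)` are realized on `Ω` by composing with some `U` satisfying `μ{U < t} = t` for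
`t ≤ s₀`. It exists because resonance and finiteness of the profile yield subsets of every
prescribed measure. -/

open scoped Function

noncomputable section

/-! ### Decreasing rearrangements and distribution functions. -/

section Rearrangement

variable {α β : Type*} [MeasurableSpace α] [MeasurableSpace β] {μ : Measure α} {ν : Measure β}

/-- The defining infimum is attained, by continuity of `μ` along increasing superlevel sets; no
measurability is needed. -/
theorem decRearr_le_iff {f : α → ℝ≥0∞} {s : ℝ} {t : ℝ≥0∞} :
    decRearr μ f s ≤ t ↔ μ {x | t < f x} ≤ ENNReal.ofReal s := by
  refine ⟨fun h => ?_, fun h => sInf_le h⟩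
  rcases eq_or_ne t ∞ with rfl | ht
  · simp
  obtain ⟨u, hu, hut, hlim⟩ := exists_seq_strictAnti_tendsto' (lt_top_iff_ne_top.2 ht)
  have hU : {x | t < f x} = ⋃ n, {x | u n < f x} := by
    ext x
    simp only [mem_ofPred_eq, mem_iUnion]
    refine ⟨fun hx => ?_, fun ⟨n, hn⟩ => (hut n).1.trans hn⟩
    exact ((tendsto_order.1 hlim).2 _ hx).exists
  have hm : Monotone fun n => {x | u n < f x} := fun m n hmn x hx =>
    lt_of_le_of_lt (hu.antitone hmn) hx
  rw [hU, hm.measure_iUnion]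
  refine iSup_le fun n => ?_
  obtain ⟨a, ha, han⟩ := sInf_lt_iff.1 (h.trans_lt (hut n).1)
  exact (measure_mono fun x hx => lt_trans han hx).trans ha

theorem lt_decRearr_iff {f : α → ℝ≥0∞} {s : ℝ} {t : ℝ≥0∞} :
    t < decRearr μ f s ↔ ENNReal.ofReal s < μ {x | t < f x} := by
  rw [← not_le, decRearr_le_iff, not_le]

theorem decRearr_antitone (f : α → ℝ≥0∞) : Antitone (decRearr μ f) := fun _ _ h =>
  decRearr_le_iff.2 ((decRearr_le_iff.1 le_rfl).trans (ENNReal.ofReal_le_ofReal h))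

theorem decRearr_le_of_dist_le {f : α → ℝ≥0∞} {g : β → ℝ≥0∞}
    (h : ∀ t, μ {x | t < f x} ≤ ν {x | t < g x}) (s : ℝ) :
    decRearr μ f s ≤ decRearr ν g s :=
  decRearr_le_iff.2 ((h _).trans (decRearr_le_iff.1 le_rfl))

theorem decRearr_eq_of_dist_eq {f : α → ℝ≥0∞} {g : β → ℝ≥0∞}
    (h : ∀ t, μ {x | t < f x} = ν {x | t < g x}) : decRearr μ f = decRearr ν g :=
  funext fun s => le_antisymm (decRearr_le_of_dist_le (fun t => (h t).le) s)
    (decRearr_le_of_dist_le (fun t => (h t).ge) s)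

theorem one_le_decRearr_indicator {A : Set α} {s : ℝ} (h : ENNReal.ofReal s < μ A) :
    1 ≤ decRearr μ (A.indicator fun _ => (1 : ℝ≥0∞)) s := by
  refine le_of_forall_lt fun t ht => lt_decRearr_iff.2 (h.trans_le (measure_mono fun x hx => ?_))
  simpa [indicator_of_mem hx] using ht

theorem RISpace.norm_congr_dist (X : RISpace μ) {f g : α → ℝ≥0∞} (hf : AEMeasurable f μ)
    (hg : AEMeasurable g μ) (h : ∀ t, μ {x | t < f x} = μ {x | t < g x}) : X.norm f = X.norm g :=
  X.rearrangement_invariant f g hf hg (decRearr_eq_of_dist_eq h)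

end Rearrangement

/-! ### Subsets of prescribed measure. -/

section Splitting

variable {Ω : Type*} [MetricSpace Ω] [MeasurableSpace Ω] {μ : Measure Ω}

/-- An infimum over an empty family is `∞`, so a finite profile at `b` already provides a set. -/
theorem exists_measure_eq (hI : AdmissibleProfile μ) {b : ℝ≥0∞} (hb : b < μ univ) :
    ∃ B, MeasurableSet B ∧ μ B = b := by
  have hbt : b ≠ ∞ := (lt_of_lt_of_le hb le_top).ne
  have h := hI.finite b.toReal ⟨ENNReal.toReal_nonneg, by rwa [ENNReal.ofReal_toReal hbt]⟩
  rw [ENNReal.ofReal_toReal hbt] at h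
  simp only [isoProfile, iInf_lt_iff] at h
  obtain ⟨A, hA, hAb, -⟩ := h
  exact ⟨A, hA, hAb⟩

/-- Resonance is tested on the indicators of `A` and of some `B₀` with `μ B₀ = b`: a function `g`
equimeasurable with the second has `∫_A g > c`. Such a `g` is at most `1` a.e. and positive on
measure at most `b`, so `A ∩ {g > 0}` works. -/
theorem exists_subset_measure_mem_Ioc (hI : AdmissibleProfile μ) (hres : IsResonant μ)
    {A : Set Ω} (hA : MeasurableSet A) {b c : ℝ≥0∞} (hbA : b ≤ μ A) (hb : b < μ univ)
    (hc : c < b) : ∃ B ⊆ A, MeasurableSet B ∧ c < μ B ∧ μ B ≤ b := by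
  obtain ⟨B₀, hB₀, hB₀b⟩ := exists_measure_eq hI hb
  have hbt : b ≠ ∞ := (lt_of_lt_of_le hb le_top).ne
  have key := hres (A.indicator fun _ => 1) (B₀.indicator fun _ => 1)
    (aemeasurable_const.indicator hA) (aemeasurable_const.indicator hB₀)
    (.of_forall fun x => by by_cases hx : x ∈ A <;> simp [hx])
    (.of_forall fun x => by by_cases hx : x ∈ B₀ <;> simp [hx])
  have hle : b ≤ ∫⁻ s in Ioi (0 : ℝ), decRearr μ (A.indicator fun _ => 1) s *
      decRearr μ (B₀.indicator fun _ => 1) s := by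
    calc b = ∫⁻ s in Ioo (0 : ℝ) b.toReal, 1 := by simp [ENNReal.ofReal_toReal hbt]
      _ ≤ ∫⁻ s in Ioo (0 : ℝ) b.toReal, decRearr μ (A.indicator fun _ => 1) s *
          decRearr μ (B₀.indicator fun _ => 1) s := by
        refine setLIntegral_mono_ae' measurableSet_Ioo (.of_forall fun s hs => ?_)
        have hsb : ENNReal.ofReal s < b := (ENNReal.ofReal_lt_iff_lt_toReal hs.1.le hbt).2 hs.2
        exact one_le_mul (one_le_decRearr_indicator (hsb.trans_le hbA))
          (one_le_decRearr_indicator (hB₀b ▸ hsb))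
      _ ≤ _ := lintegral_mono_set Ioo_subset_Ioi_self
  rw [key] at hle
  obtain ⟨g, hg⟩ := lt_iSup_iff.1 (hc.trans_le hle)
  obtain ⟨hgm, hg⟩ := lt_iSup_iff.1 hg
  obtain ⟨hgr, hg⟩ := lt_iSup_iff.1 hg
  have hg1 : μ {x | 1 < g x} = 0 := by
    have : decRearr μ g 0 ≤ 1 := by
      rw [hgr, decRearr_le_iff]
      have : {x | (1 : ℝ≥0∞) < B₀.indicator (fun _ => 1) x} = ∅ := by
        ext x; by_cases hx : x ∈ B₀ <;> simp [hx]
      simp [this]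
    simpa using decRearr_le_iff.1 this
  have hg0 : μ {x | 0 < g x} ≤ b := by
    have : decRearr μ g b.toReal ≤ 0 := by
      rw [hgr, decRearr_le_iff, ENNReal.ofReal_toReal hbt, ← hB₀b]
      refine measure_mono fun x hx => ?_
      by_contra h
      simp [h] at hx
    simpa [ENNReal.ofReal_toReal hbt] using decRearr_le_iff.1 this
  have hmk := hgm.ae_eq_mk
  have hBm : MeasurableSet (A ∩ {x | 0 < hgm.mk g x}) :=
    hA.inter (measurableSet_lt measurable_const hgm.measurable_mk)
  refine ⟨A ∩ {x | 0 < hgm.mk g x}, inter_subset_left, hBm, ?_, ?_⟩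
  · refine hg.trans_le ?_
    calc ∫⁻ x, A.indicator (fun _ => 1) x * g x ∂μ
        ≤ ∫⁻ x, (A ∩ {x | 0 < hgm.mk g x}).indicator (fun _ => 1) x ∂μ := by
          refine lintegral_mono_ae ?_
          have h1 : ∀ᵐ x ∂μ, ¬ 1 < g x := by simpa [ae_iff] using hg1
          filter_upwards [hmk, h1] with x hx hx1
          rw [not_lt] at hx1
          by_cases hxA : x ∈ A
          · rcases eq_or_ne (g x) 0 with h0 | h0
            · simp [h0]
            · have : x ∈ A ∩ {x | 0 < hgm.mk g x} := ⟨hxA, by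
                simpa [← hx] using pos_iff_ne_zero.2 h0⟩
              simpa [indicator_of_mem this, hxA] using hx1
          · simp [hxA]
      _ = _ := by simp [lintegral_indicator hBm]
  · refine le_trans ?_ hg0
    refine measure_mono_ae ?_
    filter_upwards [hmk] with x hx hxm
    have : 0 < hgm.mk g x := hxm.2
    exact (hx ▸ this : 0 < g x)

/-- Exhaustion: each enlargement at least halves the missing measure `b - μ B`. -/
theorem exists_subset_measure_eq (hI : AdmissibleProfile μ) (hres : IsResonant μ)
    {A : Set Ω} (hA : MeasurableSet A) {b : ℝ≥0∞} (hbA : b ≤ μ A) (hb : b < μ univ) :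
    ∃ B ⊆ A, MeasurableSet B ∧ μ B = b := by
  have hbt : b ≠ ∞ := (lt_of_lt_of_le hb le_top).ne
  have step : ∀ B : {B : Set Ω // B ⊆ A ∧ MeasurableSet B ∧ μ B ≤ b},
      ∃ B' : {B : Set Ω // B ⊆ A ∧ MeasurableSet B ∧ μ B ≤ b},
        B.1 ⊆ B'.1 ∧ b - μ B'.1 ≤ (b - μ B.1) / 2 := by
    rintro ⟨B, hBA, hB, hBb⟩
    have hBt : μ B ≠ ∞ := ne_top_of_le_ne_top hbt hBb
    rcases eq_or_ne (b - μ B) 0 with h0 | h0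
    · exact ⟨⟨B, hBA, hB, hBb⟩, Subset.rfl, by simp [h0]⟩
    have hd : μ (A \ B) = μ A - μ B := measure_sdiff hBA hB.nullMeasurableSet hBt
    obtain ⟨D, hDA, hD, hD1, hD2⟩ := exists_subset_measure_mem_Ioc hI hres (hA.diff hB)
      (b := b - μ B) (c := (b - μ B) / 2) (by rw [hd]; gcongr) (tsub_le_self.trans_lt hb)
      (ENNReal.half_lt_self h0 (ne_top_of_le_ne_top hbt tsub_le_self))
    have hdisj : Disjoint B D := disjoint_left.2 fun x hxB hxD => (hDA hxD).2 hxB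
    have hm : μ (B ∪ D) = μ B + μ D := measure_union hdisj hD
    refine ⟨⟨B ∪ D, union_subset hBA (hDA.trans sdiff_subset), hB.union hD, ?_⟩,
      subset_union_left, ?_⟩
    · rw [hm]
      calc μ B + μ D ≤ μ B + (b - μ B) := by gcongr
        _ = b := add_tsub_cancel_of_le hBb
    · change b - μ (B ∪ D) ≤ (b - μ B) / 2
      rw [hm, ← tsub_tsub]
      refine tsub_le_iff_right.2 ?_
      calc b - μ B = (b - μ B) / 2 + (b - μ B) / 2 := (ENNReal.add_halves _).symm
        _ ≤ _ := by gcongr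
  choose F hF1 hF2 using step
  let S : ℕ → {B : Set Ω // B ⊆ A ∧ MeasurableSet B ∧ μ B ≤ b} := fun n =>
    F^[n] ⟨∅, empty_subset _, MeasurableSet.empty, by simp⟩
  have hS : ∀ n, S (n + 1) = F (S n) := fun n => Function.iterate_succ_apply' _ _ _
  have hmono : Monotone fun n => (S n).1 := monotone_nat_of_le_succ fun n => by
    rw [hS]; exact hF1 _
  have hdec : ∀ n, b - μ (S n).1 ≤ b * (2⁻¹) ^ n := by
    intro n
    induction n with
    | zero => simp
    | succ n ih =>
      rw [hS]
      refine (hF2 _).trans ?_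
      rw [pow_succ, ← mul_assoc, div_eq_mul_inv]
      gcongr
  refine ⟨⋃ n, (S n).1, iUnion_subset fun n => (S n).2.1,
    MeasurableSet.iUnion fun n => (S n).2.2.1, le_antisymm ?_ ?_⟩
  · rw [hmono.measure_iUnion]; exact iSup_le fun n => (S n).2.2.2
  · have hle : ∀ n, b - μ (⋃ n, (S n).1) ≤ b * (2⁻¹) ^ n := fun n =>
      (tsub_le_tsub_left (measure_mono (subset_iUnion (fun n => (S n).1) n)) _).trans (hdec n)
    have hlim : Tendsto (fun n : ℕ => b * (2⁻¹ : ℝ≥0∞) ^ n) atTop (𝓝 (b * 0)) :=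
      ENNReal.Tendsto.const_mul (ENNReal.tendsto_pow_atTop_nhds_zero_of_lt_one
        (by simp)) (Or.inr hbt)
    rw [mul_zero] at hlim
    exact tsub_eq_zero_iff_le.1 (nonpos_iff_eq_zero.1 (ge_of_tendsto' hlim hle))

end Splitting

/-! ### Functions with uniform distribution. -/

section Uniform

variable {Ω : Type*} [MeasurableSpace Ω] {μ : Measure Ω}

/-- Appends one binary digit to the address `N`, by halving every cell. -/
theorem exists_binary_refinement {Ω₀ : Set Ω} (hΩ₀ : MeasurableSet Ω₀)
    (hhalf : ∀ A ⊆ Ω₀, MeasurableSet A → ∃ B ⊆ A, MeasurableSet B ∧ μ B = μ A / 2)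
    (hfin : μ Ω₀ ≠ ∞) {N : Ω → ℕ} (hN : Measurable N) :
    ∃ N' : Ω → ℕ, Measurable N' ∧ (∀ x, N' x = 2 * N x ∨ N' x = 2 * N x + 1) ∧
      ∀ i, μ (Ω₀ ∩ {x | N' x = 2 * i}) = μ (Ω₀ ∩ {x | N x = i}) / 2 ∧
        μ (Ω₀ ∩ {x | N' x = 2 * i + 1}) = μ (Ω₀ ∩ {x | N x = i}) / 2 := by
  classical
  have hm : ∀ i, MeasurableSet (Ω₀ ∩ {x | N x = i}) := fun i =>
    hΩ₀.inter (hN (measurableSet_singleton i))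
  choose D hD1 hD2 hD3 using fun i => hhalf (Ω₀ ∩ {x | N x = i}) inter_subset_left (hm i)
  have hDm : MeasurableSet (⋃ i, D i) := MeasurableSet.iUnion hD2
  have hmem : ∀ {x i}, N x = i → (x ∈ ⋃ j, D j ↔ x ∈ D i) := by
    intro x i hx
    refine ⟨fun h => ?_, fun h => mem_iUnion.2 ⟨i, h⟩⟩
    obtain ⟨j, hj⟩ := mem_iUnion.1 h
    have : N x = j := (hD1 j hj).2
    rwa [← hx, this]
  refine ⟨fun x => 2 * N x + if x ∈ ⋃ i, D i then 1 else 0,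
    (hN.const_mul 2).add (Measurable.ite hDm measurable_const measurable_const), fun x => ?_,
    fun i => ⟨?_, ?_⟩⟩
  · dsimp only; split_ifs <;> simp
  · have : Ω₀ ∩ {x | (2 * N x + if x ∈ ⋃ i, D i then 1 else 0) = 2 * i} =
        (Ω₀ ∩ {x | N x = i}) \ D i := by
      ext x
      simp only [mem_inter_iff, mem_ofPred_eq, Set.mem_sdiff]
      constructor
      · rintro ⟨hx, h⟩
        have hN' : N x = i := by split_ifs at h <;> omega
        refine ⟨⟨hx, hN'⟩, fun hxD => ?_⟩
        rw [if_pos ((hmem hN').2 hxD)] at h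
        omega
      · rintro ⟨⟨hx, h⟩, hxD⟩
        refine ⟨hx, ?_⟩
        rw [if_neg (fun h' => hxD ((hmem h).1 h')), h, add_zero]
    rw [this, measure_sdiff (hD1 i) (hD2 i).nullMeasurableSet
      (ne_top_of_le_ne_top hfin (measure_mono ((hD1 i).trans inter_subset_left))), hD3]
    exact ENNReal.sub_half (ne_top_of_le_ne_top hfin (measure_mono inter_subset_left))
  · have : Ω₀ ∩ {x | (2 * N x + if x ∈ ⋃ i, D i then 1 else 0) = 2 * i + 1} = D i := by
      ext x
      simp only [mem_inter_iff, mem_ofPred_eq]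
      constructor
      · rintro ⟨hx, h⟩
        have hN' : N x = i := by split_ifs at h <;> omega
        by_contra hxD
        rw [if_neg (fun h' => hxD ((hmem hN').1 h'))] at h
        omega
      · intro hxD
        have h := hD1 i hxD
        refine ⟨h.1, ?_⟩
        rw [if_pos ((hmem h.2).2 hxD)]
        have := h.2
        simp only [mem_ofPred_eq] at this
        omega
    rw [this, hD3]

/-- Iterated halving gives binary addresses; their limit `V` is uniform on `[0, 1]`. `U` is `s₀ V`
on `Ω₀` and `s₀` elsewhere, so the complement never counts for `t ≤ s₀`. -/
theorem exists_uniform_of_halving {Ω₀ : Set Ω} (hΩ₀ : MeasurableSet Ω₀)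
    (hhalf : ∀ A ⊆ Ω₀, MeasurableSet A → ∃ B ⊆ A, MeasurableSet B ∧ μ B = μ A / 2)
    {s₀ : ℝ} (hs₀ : 0 < s₀) (hμ : μ Ω₀ = ENNReal.ofReal s₀) :
    ∃ U : Ω → ℝ, Measurable U ∧ (∀ x, 0 ≤ U x) ∧
      ∀ t, 0 ≤ t → t ≤ s₀ → μ {x | U x < t} = ENNReal.ofReal t := by
  classical
  have hfin : μ Ω₀ ≠ ∞ := by simp [hμ]
  choose R hR1 hR2 hR3 using fun N : {N : Ω → ℕ // Measurable N} =>
    exists_binary_refinement hΩ₀ hhalf hfin N.2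
  let S : ℕ → {N : Ω → ℕ // Measurable N} := fun l =>
    (fun N => ⟨R N, hR1 N⟩)^[l] ⟨fun _ => 0, measurable_const⟩
  let N : ℕ → Ω → ℕ := fun l => (S l).1
  have hNm : ∀ l, Measurable (N l) := fun l => (S l).2
  have hS : ∀ l, S (l + 1) = ⟨R (S l), hR1 (S l)⟩ := fun l => Function.iterate_succ_apply' _ _ _
  have hN : ∀ l x, N (l + 1) x = 2 * N l x ∨ N (l + 1) x = 2 * N l x + 1 := fun l x => by
    simp only [N, hS]; exact hR2 _ x
  have hNμ : ∀ l i, i < 2 ^ l → μ (Ω₀ ∩ {x | N l x = i}) = ENNReal.ofReal (s₀ / 2 ^ l) := by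
    intro l
    induction l with
    | zero =>
      intro i hi
      obtain rfl : i = 0 := by simpa using hi
      simp [N, S, hμ]
    | succ l ih =>
      intro i hi
      have h2 : ENNReal.ofReal (s₀ / 2 ^ l) / 2 = ENNReal.ofReal (s₀ / 2 ^ (l + 1)) := by
        rw [pow_succ, ← div_div, ENNReal.ofReal_div_of_pos two_pos (x := s₀ / 2 ^ l)]; simp
      have hil : i / 2 < 2 ^ l := by rw [pow_succ] at hi; omega
      rcases Nat.even_or_odd' i with ⟨j, rfl | rfl⟩
      · have := (hR3 (S l) j).1
        simp only [N, hS]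
        rw [this, ← h2, ← ih j (by omega)]
      · have := (hR3 (S l) j).2
        simp only [N, hS]
        rw [this, ← h2, ← ih j (by omega)]
  have hNlt : ∀ l i, i ≤ 2 ^ l → μ (Ω₀ ∩ {x | N l x < i}) = ENNReal.ofReal (s₀ * (i / 2 ^ l)) := by
    intro l i
    induction i with
    | zero => simp
    | succ i ih =>
      intro hi
      have : Ω₀ ∩ {x | N l x < i + 1} = (Ω₀ ∩ {x | N l x < i}) ∪ (Ω₀ ∩ {x | N l x = i}) := by
        ext x; simp only [mem_inter_iff, mem_union, mem_ofPred_eq, Nat.lt_succ_iff_lt_or_eq]; tauto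
      have hm : MeasurableSet (Ω₀ ∩ {x | N l x = i}) :=
        hΩ₀.inter (hNm l (measurableSet_singleton i))
      rw [this, measure_union _ hm, ih (by omega),
        hNμ l i (by omega), ← ENNReal.ofReal_add (by positivity) (by positivity)]
      · congr 1; push_cast; ring
      · refine disjoint_left.2 fun x hx hx' => ?_
        have h1 := hx.2
        have h2 := hx'.2
        simp only [mem_ofPred_eq] at h1 h2
        omega
  let v : ℕ → Ω → ℝ := fun l x => N l x / 2 ^ l
  have hvm : ∀ x, Monotone fun l => v l x := fun x => monotone_nat_of_le_succ fun l => by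
    have h : (2 * N l x : ℝ) ≤ N (l + 1) x := by
      rcases hN l x with h | h <;> rw [h] <;> push_cast <;> linarith
    simp only [v]
    rw [div_le_div_iff₀ (by positivity) (by positivity), pow_succ]
    nlinarith [show (0 : ℝ) < 2 ^ l by positivity]
  have hva : ∀ x, Antitone fun l => v l x + 1 / 2 ^ l := fun x => antitone_nat_of_succ_le fun l => by
    have h : (N (l + 1) x : ℝ) ≤ 2 * N l x + 1 := by
      rcases hN l x with h | h <;> rw [h] <;> push_cast <;> linarith
    simp only [v]
    rw [← add_div, ← add_div, div_le_div_iff₀ (by positivity) (by positivity), pow_succ]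
    nlinarith [show (0 : ℝ) < 2 ^ l by positivity]
  have hvle : ∀ x k l, v k x ≤ v l x + 1 / 2 ^ l := fun x k l => by
    calc v k x ≤ v (max k l) x := hvm x (le_max_left _ _)
      _ ≤ v (max k l) x + 1 / 2 ^ (max k l) := by simp
      _ ≤ _ := hva x (le_max_right _ _)
  have hbdd : ∀ x, BddAbove (range fun l => v l x) := fun x =>
    ⟨v 0 x + 1 / 2 ^ 0, by rintro _ ⟨k, rfl⟩; exact hvle x k 0⟩
  let V : Ω → ℝ := fun x => ⨆ l, v l x
  have hV1 : ∀ x l, v l x ≤ V x := fun x l => le_ciSup (hbdd x) l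
  have hV2 : ∀ x l, V x ≤ v l x + 1 / 2 ^ l := fun x l => ciSup_le fun k => hvle x k l
  have hVm : Measurable V := Measurable.iSup fun l =>
    (measurable_from_nat.comp (hNm l)).div_const _
  have hv0 : ∀ l x, 0 ≤ v l x := fun l x => by positivity
  refine ⟨fun x => if x ∈ Ω₀ then s₀ * V x else s₀,
    Measurable.ite hΩ₀ (hVm.const_mul _) measurable_const, fun x => ?_, fun t ht0 ht => ?_⟩
  · dsimp only
    split_ifs
    · exact mul_nonneg hs₀.le ((hv0 0 x).trans (hV1 x 0))
    · exact hs₀.le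
  have hset : {x | (if x ∈ Ω₀ then s₀ * V x else s₀) < t} = Ω₀ ∩ {x | V x < t / s₀} := by
    ext x
    simp only [mem_ofPred_eq, mem_inter_iff]
    by_cases hx : x ∈ Ω₀
    · simp [hx, lt_div_iff₀ hs₀, mul_comm]
    · simp [hx, ht]
  rw [hset]
  set τ := t / s₀ with hτ
  have hτ0 : 0 ≤ τ := by positivity
  have hτ1 : τ ≤ 1 := (div_le_one hs₀).2 ht
  have hts : t = s₀ * τ := by rw [hτ]; field_simp
  have hlim0 : Tendsto (fun l : ℕ => (1 : ℝ) / 2 ^ l) atTop (𝓝 0) := by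
    simpa using tendsto_pow_atTop_nhds_zero_of_lt_one (r := (2 : ℝ)⁻¹) (by norm_num) (by norm_num)
  have hceil : ∀ l : ℕ, ⌈τ * 2 ^ l⌉₊ ≤ 2 ^ l := fun l => by
    refine Nat.ceil_le.2 ?_
    push_cast
    exact mul_le_of_le_one_left (by positivity) hτ1
  rcases hτ0.eq_or_lt with h0 | hpos
  · have : Ω₀ ∩ {x | V x < τ} = ∅ := by
      ext x
      simp only [mem_inter_iff, mem_ofPred_eq, mem_empty_iff_false, iff_false, not_and, not_lt]
      exact fun _ => h0 ▸ (hv0 0 x).trans (hV1 x 0)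
    rw [this, hts, ← h0]; simp
  refine le_antisymm ?_ ?_
  · have hle : ∀ l : ℕ, μ (Ω₀ ∩ {x | V x < τ}) ≤ ENNReal.ofReal (s₀ * (τ + 1 / 2 ^ l)) := fun l => by
      have hsub : Ω₀ ∩ {x | V x < τ} ⊆ Ω₀ ∩ {x | N l x < ⌈τ * 2 ^ l⌉₊} := by
        refine inter_subset_inter_right _ fun x hx => ?_
        have h1 := (hV1 x l).trans_lt hx
        rw [div_lt_iff₀ (by positivity)] at h1
        exact Nat.lt_ceil.2 h1
      refine (measure_mono hsub).trans ?_
      rw [hNlt l _ (hceil l)]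
      refine ENNReal.ofReal_le_ofReal ?_
      gcongr
      have h2 := Nat.ceil_lt_add_one (a := τ * 2 ^ l) (by positivity)
      rw [div_le_iff₀ (by positivity), add_mul, one_div, inv_mul_cancel₀ (by positivity)]
      exact h2.le
    have hlim := ENNReal.tendsto_ofReal ((hlim0.const_add τ).const_mul s₀)
    rw [add_zero, ← hts] at hlim
    exact ge_of_tendsto' hlim hle
  · have hle : ∀ l : ℕ, ENNReal.ofReal (s₀ * (τ - 1 / 2 ^ l)) ≤ μ (Ω₀ ∩ {x | V x < τ}) := fun l => by
      have hcpos : 0 < ⌈τ * 2 ^ l⌉₊ := Nat.ceil_pos.2 (by positivity)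
      -- The error in `V ≤ v l + 1 / 2 ^ l` costs one cell, hence the `- 1`.
      have hsub : Ω₀ ∩ {x | N l x < ⌈τ * 2 ^ l⌉₊ - 1} ⊆ Ω₀ ∩ {x | V x < τ} := by
        refine inter_subset_inter_right _ fun x hx => ?_
        have hx' : N l x + 1 < ⌈τ * 2 ^ l⌉₊ := by
          simp only [mem_ofPred_eq] at hx; omega
        have h3 := Nat.lt_ceil.1 hx'
        refine (hV2 x l).trans_lt ?_
        simp only [v]
        rw [← add_div, div_lt_iff₀ (by positivity)]
        exact_mod_cast h3
      refine le_trans ?_ (measure_mono hsub)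
      rw [hNlt l _ ((Nat.sub_le _ _).trans (hceil l))]
      refine ENNReal.ofReal_le_ofReal ?_
      gcongr
      have h2 := Nat.le_ceil (τ * 2 ^ l)
      rw [Nat.cast_sub hcpos, le_div_iff₀ (by positivity), sub_mul, one_div,
        inv_mul_cancel₀ (by positivity)]
      push_cast
      linarith
    have hlim := ENNReal.tendsto_ofReal ((hlim0.const_sub τ).const_mul s₀)
    rw [sub_zero, ← hts] at hlim
    exact le_of_tendsto' hlim hle

/-- A non-negative function whose distribution is uniform up to level `s₀`. -/
structure IsUniform (μ : Measure Ω) (s₀ : ℝ) (U : Ω → ℝ) : Prop where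
  measurable : Measurable U
  nonneg : ∀ x, 0 ≤ U x
  measure_lt : ∀ t, 0 ≤ t → t ≤ s₀ → μ {x | U x < t} = ENNReal.ofReal t

namespace IsUniform

variable {s₀ : ℝ} {U : Ω → ℝ}

theorem measure_Ico (hU : IsUniform μ s₀ U) {a b : ℝ} (ha : 0 ≤ a) (hab : a ≤ b) (hb : b ≤ s₀) :
    μ (U ⁻¹' Ico a b) = ENNReal.ofReal (b - a) := by
  have : U ⁻¹' Ico a b = {x | U x < b} \ {x | U x < a} := by
    ext x; simp [and_comm]
  have hma := hU.measure_lt a ha (hab.trans hb)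
  have hsub : {x | U x < a} ⊆ {x | U x < b} := fun x hx => lt_of_lt_of_le hx hab
  rw [this, measure_sdiff hsub
    (measurableSet_lt hU.measurable measurable_const).nullMeasurableSet (by simp [hma]),
    hma, hU.measure_lt b (ha.trans hab) hb, ← ENNReal.ofReal_sub _ ha]

/-- Finite measures on the line are determined by half-lines. The restriction is needed because
nothing is known about `U` above `s₀`. -/
theorem map_restrict (hU : IsUniform μ s₀ U) (hs₀ : 0 ≤ s₀) :
    (μ.restrict (U ⁻¹' Ico 0 s₀)).map U = volume.restrict (Ico 0 s₀) := by
  have hm : MeasurableSet (U ⁻¹' Ico 0 s₀) := hU.measurable measurableSet_Ico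
  have : IsFiniteMeasure (μ.restrict (U ⁻¹' Ico 0 s₀)) :=
    ⟨by simp [hU.measure_Ico le_rfl hs₀ le_rfl]⟩
  refine Measure.ext_of_Ici _ _ fun a => ?_
  rw [Measure.map_apply hU.measurable measurableSet_Ici,
    Measure.restrict_apply (hU.measurable measurableSet_Ici),
    Measure.restrict_apply measurableSet_Ici, ← preimage_inter]
  have : Ici a ∩ Ico 0 s₀ = Ico (max a 0) s₀ := by ext; simp [and_assoc]
  rw [this, Real.volume_Ico]
  rcases le_total (max a 0) s₀ with h | h
  · exact hU.measure_Ico (le_max_right _ _) h le_rfl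
  · rw [Ico_eq_empty (not_lt.2 h), ENNReal.ofReal_of_nonpos (by linarith)]; simp

/-- Needed because the dyadic intervals cover `(0, s₀)` but not `0`. -/
theorem ae_pos (hU : IsUniform μ s₀ U) (hs₀ : 0 < s₀) : ∀ᵐ x ∂μ, 0 < U x := by
  have h0 : ∀ n : ℕ, μ {x | U x ≤ 0} ≤ ENNReal.ofReal (s₀ * (1 / (n + 1))) := fun n => by
    have hn : (1 : ℝ) / (n + 1) ≤ 1 := (div_le_one (by positivity)).2 (by linarith)
    rw [← hU.measure_lt _ (by positivity) (mul_le_of_le_one_right hs₀.le hn)]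
    refine measure_mono fun x hx => ?_
    have hx : U x ≤ 0 := hx
    exact hx.trans_lt (by positivity)
  have hlim := ENNReal.tendsto_ofReal (tendsto_one_div_add_atTop_nhds_zero_nat.const_mul s₀)
  rw [mul_zero, ENNReal.ofReal_zero] at hlim
  simpa [ae_iff] using ge_of_tendsto' hlim h0

end IsUniform

end Uniform

theorem exists_isUniform {Ω : Type*} [MetricSpace Ω] [MeasurableSpace Ω] {μ : Measure Ω}
    (hI : AdmissibleProfile μ) (hres : IsResonant μ) {s₀ : ℝ} (hs₀ : 0 < s₀)
    (hlt : ENNReal.ofReal s₀ < μ univ) : ∃ U : Ω → ℝ, IsUniform μ s₀ U := by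
  obtain ⟨Ω₀, -, hΩ₀, hμ⟩ := exists_subset_measure_eq hI hres MeasurableSet.univ hlt.le hlt
  obtain ⟨U, h1, h2, h3⟩ := exists_uniform_of_halving hΩ₀ (fun A hA hAm =>
    exists_subset_measure_eq hI hres hAm ENNReal.half_le_self
      ((ENNReal.half_le_self.trans (measure_mono hA)).trans_lt (hμ ▸ hlt))) hs₀ hμ
  exact ⟨U, h1, h2, h3⟩

/-! ### Dyadic step functions and dilation. -/

section StepFunctions

theorem tsum_indicator_of_mem {ι α : Type*} {A : ι → Set α} (hA : Pairwise (Disjoint on A))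
    (g : ι → α → ℝ≥0∞) {i : ι} {x : α} (hx : x ∈ A i) : ∑' j, (A j).indicator (g j) x = g i x := by
  rw [tsum_eq_single i, indicator_of_mem hx]
  exact fun j hj => indicator_of_notMem (fun h => disjoint_left.1 (hA hj) h hx) _

variable {α : Type*} [MeasurableSpace α] {μ : Measure α}

theorem measure_lt_tsum_indicator {ι : Type*} [Countable ι] {A : ι → Set α}
    (hA : Pairwise (Disjoint on A)) (hAm : ∀ i, MeasurableSet (A i)) {g : ι → α → ℝ≥0∞}
    (hg : ∀ i, Measurable (g i)) (t : ℝ≥0∞) :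
    μ {x | t < ∑' i, (A i).indicator (g i) x} = ∑' i, μ (A i ∩ {x | t < g i x}) := by
  have : {x | t < ∑' i, (A i).indicator (g i) x} = ⋃ i, A i ∩ {x | t < g i x} := by
    ext x
    simp only [mem_ofPred_eq, mem_iUnion, mem_inter_iff]
    constructor
    · intro h
      by_cases hx : ∃ i, x ∈ A i
      · obtain ⟨i, hi⟩ := hx
        rw [tsum_indicator_of_mem hA g hi] at h
        exact ⟨i, hi, h⟩
      · push Not at hx
        simp [hx] at h
    · rintro ⟨i, hi, h⟩
      rwa [tsum_indicator_of_mem hA g hi]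
  rw [this, measure_iUnion]
  · exact fun i j hij => (hA hij).mono inter_subset_left inter_subset_left
  · exact fun i => (hAm i).inter (measurableSet_lt measurable_const (hg i))

namespace IsUniform

variable {s₀ : ℝ} {U : α → ℝ}

theorem measure_lt_step (hU : IsUniform μ s₀ U) {ι : Type*} [Countable ι] {l r : ι → ℝ}
    (hdisj : Pairwise (Disjoint on fun i => Ico (l i) (r i))) (hl : ∀ i, 0 ≤ l i)
    (hlr : ∀ i, l i ≤ r i) (hr : ∀ i, r i ≤ s₀) (c : ι → ℝ≥0∞) (t : ℝ≥0∞) :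
    μ {x | t < ∑' i, (Ico (l i) (r i)).indicator (fun _ => c i) (U x)} =
      ∑' i, if t < c i then ENNReal.ofReal (r i - l i) else 0 := by
  have h := measure_lt_tsum_indicator (μ := μ) (A := fun i => U ⁻¹' Ico (l i) (r i))
    (fun i j hij => (hdisj hij).preimage U) (fun i => hU.measurable measurableSet_Ico)
    (g := fun i _ => c i) (fun i => measurable_const) t
  refine Eq.trans h (tsum_congr fun i => ?_)
  split_ifs with hc
  · simp [hc, hU.measure_Ico (hl i) (hlr i) (hr i)]
  · simp [hc]

/-- `f*(U) > t` means `U < μ{f > t}`, and uniformity of `U` up to `s₀` applies since the support is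
that small. -/
theorem measure_lt_decRearr_comp (hU : IsUniform μ s₀ U) {f : α → ℝ≥0∞}
    (hf : μ {x | 0 < f x} ≤ ENNReal.ofReal s₀) (hs₀ : 0 ≤ s₀) (t : ℝ≥0∞) :
    μ {x | t < decRearr μ f (U x)} = μ {x | t < f x} := by
  have hm : μ {x | t < f x} ≤ ENNReal.ofReal s₀ :=
    (measure_mono (show {x | t < f x} ⊆ {x | 0 < f x} from
      fun x (hx : t < f x) => pos_of_gt hx)).trans hf
  have hfin : μ {x | t < f x} ≠ ∞ := ne_top_of_le_ne_top ENNReal.ofReal_ne_top hm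
  have : {x | t < decRearr μ f (U x)} = {x | U x < (μ {x | t < f x}).toReal} := by
    ext x
    simp only [mem_ofPred_eq]
    rw [lt_decRearr_iff, ENNReal.ofReal_lt_iff_lt_toReal (hU.nonneg x) hfin]
  rw [this, hU.measure_lt _ ENNReal.toReal_nonneg (ENNReal.toReal_le_of_le_ofReal hs₀ hm),
    ENNReal.ofReal_toReal hfin]

theorem norm_decRearr_comp (hU : IsUniform μ s₀ U) (X : RISpace μ) {f : α → ℝ≥0∞}
    (hfm : AEMeasurable f μ) (hf : μ {x | 0 < f x} ≤ ENNReal.ofReal s₀) (hs₀ : 0 ≤ s₀) :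
    X.norm (fun x => decRearr μ f (U x)) = X.norm f :=
  X.norm_congr_dist ((decRearr_antitone f).measurable.comp hU.measurable).aemeasurable hfm
    (hU.measure_lt_decRearr_comp hf hs₀)

/-- Composing the rearrangements with `U` turns an inequality of distributions into a pointwise one,
to which monotonicity of the norm applies. -/
theorem norm_le_of_dist_le (hU : IsUniform μ s₀ U) (X : RISpace μ) {f g : α → ℝ≥0∞}
    (hfm : AEMeasurable f μ) (hgm : AEMeasurable g μ) (hf : μ {x | 0 < f x} ≤ ENNReal.ofReal s₀)
    (hs₀ : 0 ≤ s₀) (h : ∀ t, μ {x | t < g x} ≤ μ {x | t < f x}) : X.norm g ≤ X.norm f := by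
  rw [← hU.norm_decRearr_comp X hfm hf hs₀, ← hU.norm_decRearr_comp X hgm ((h 0).trans hf) hs₀]
  exact X.norm_mono _ _ ((decRearr_antitone g).measurable.comp hU.measurable).aemeasurable
    ((decRearr_antitone f).measurable.comp hU.measurable).aemeasurable
    (.of_forall fun x => decRearr_le_of_dist_le h _)

end IsUniform

/-- The function with value `a k` on the dyadic interval `[s₀ / 2 ^ (k + 1), s₀ / 2 ^ k)`. -/
def dyadicStep (s₀ : ℝ) (a : ℕ → ℝ≥0∞) (s : ℝ) : ℝ≥0∞ :=
  ∑' k, (Ico (s₀ / 2 ^ (k + 1)) (s₀ / 2 ^ k)).indicator (fun _ => a k) s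

variable {s₀ : ℝ}

theorem dyadic_antitone (hs₀ : 0 ≤ s₀) : Antitone fun k : ℕ => s₀ / 2 ^ k := fun _ _ h =>
  div_le_div_of_nonneg_left hs₀ (by positivity) (pow_le_pow_right₀ one_le_two h)

theorem pairwise_disjoint_dyadic (hs₀ : 0 ≤ s₀) :
    Pairwise (Disjoint on fun k : ℕ => Ico (s₀ / 2 ^ (k + 1)) (s₀ / 2 ^ k)) :=
  (dyadic_antitone hs₀).pairwise_disjoint_on_Ico_succ

theorem dyadicStep_of_mem (hs₀ : 0 ≤ s₀) (a : ℕ → ℝ≥0∞) {k : ℕ} {s : ℝ}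
    (hs : s ∈ Ico (s₀ / 2 ^ (k + 1)) (s₀ / 2 ^ k)) : dyadicStep s₀ a s = a k :=
  tsum_indicator_of_mem (pairwise_disjoint_dyadic hs₀) (fun k _ => a k) hs

theorem exists_mem_dyadic {s : ℝ} (hs : 0 < s) (hss₀ : s < s₀) :
    ∃ k : ℕ, s ∈ Ico (s₀ / 2 ^ (k + 1)) (s₀ / 2 ^ k) := by
  obtain ⟨k, hk1, hk2⟩ := exists_nat_pow_near (x := s₀ / s) (y := 2)
    ((one_le_div hs).2 hss₀.le) one_lt_two
  rw [le_div_iff₀ hs] at hk1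
  rw [div_lt_iff₀ hs] at hk2
  -- If `s₀ / s` is exactly a power of two, `s` is the left endpoint of the preceding interval.
  rcases hk1.eq_or_lt with h | h
  · cases k with
    | zero => simp at h; linarith
    | succ k =>
      refine ⟨k, ?_, ?_⟩
      · rw [div_le_iff₀ (by positivity)]; linarith
      · rw [lt_div_iff₀ (by positivity)]; rw [pow_succ] at h
        nlinarith [show (0 : ℝ) < 2 ^ k by positivity, mul_pos (show (0 : ℝ) < 2 ^ k by positivity) hs]
  · refine ⟨k, ?_, ?_⟩
    · rw [div_le_iff₀ (by positivity)]; linarith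
    · rw [lt_div_iff₀ (by positivity)]; linarith

theorem dyadicStep_of_le (hs₀ : 0 ≤ s₀) (a : ℕ → ℝ≥0∞) {s : ℝ} (hs : s₀ ≤ s) :
    dyadicStep s₀ a s = 0 := by
  refine ENNReal.tsum_eq_zero.2 fun k => indicator_of_notMem (fun h => ?_) _
  have := dyadic_antitone hs₀ (Nat.zero_le k)
  simp only [pow_zero, div_one] at this
  linarith [h.2]

theorem dyadicStep_of_nonpos (hs₀ : 0 < s₀) (a : ℕ → ℝ≥0∞) {s : ℝ} (hs : s ≤ 0) :
    dyadicStep s₀ a s = 0 := by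
  refine ENNReal.tsum_eq_zero.2 fun k => indicator_of_notMem (fun h => ?_) _
  have : 0 < s₀ / 2 ^ (k + 1) := by positivity
  linarith [h.1]

theorem measurable_dyadicStep (s₀ : ℝ) (a : ℕ → ℝ≥0∞) : Measurable (dyadicStep s₀ a) :=
  Measurable.tsum fun _ => measurable_const.indicator measurableSet_Ico

theorem dyadicStep_cases (hs₀ : 0 < s₀) (s : ℝ) : (∀ a, dyadicStep s₀ a s = 0) ∨
    ∃ k : ℕ, s ∈ Ico (s₀ / 2 ^ (k + 1)) (s₀ / 2 ^ k) := by
  rcases le_or_gt s 0 with h | h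
  · exact Or.inl fun a => dyadicStep_of_nonpos hs₀ a h
  rcases le_or_gt s₀ s with h' | h'
  · exact Or.inl fun a => dyadicStep_of_le hs₀.le a h'
  · exact Or.inr (exists_mem_dyadic h h')

theorem dyadicStep_mono (s₀ : ℝ) {a b : ℕ → ℝ≥0∞} (h : ∀ k, a k ≤ b k) (s : ℝ) :
    dyadicStep s₀ a s ≤ dyadicStep s₀ b s :=
  ENNReal.tsum_le_tsum fun k => indicator_le_indicator (h k)

theorem dyadicStep_const_mul (s₀ : ℝ) (c : ℝ≥0∞) (a : ℕ → ℝ≥0∞) (s : ℝ) :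
    dyadicStep s₀ (fun k => c * a k) s = c * dyadicStep s₀ a s := by
  rw [dyadicStep, dyadicStep, ← ENNReal.tsum_mul_left]
  refine tsum_congr fun k => ?_
  by_cases h : s ∈ Ico (s₀ / 2 ^ (k + 1)) (s₀ / 2 ^ k) <;> simp [h]

theorem tsum_ofReal_dyadic (hs₀ : 0 ≤ s₀) :
    ∑' k : ℕ, ENNReal.ofReal (s₀ / 2 ^ (k + 1)) = ENNReal.ofReal s₀ := by
  have : ∀ k : ℕ, s₀ / 2 ^ (k + 1) = s₀ / 2 / 2 ^ k := fun k => by rw [pow_succ]; field_simp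
  simp_rw [this]
  rw [← ENNReal.ofReal_tsum_of_nonneg (fun k => by positivity) (summable_geometric_two' s₀),
    tsum_geometric_two']

namespace IsUniform

variable {U : α → ℝ}

theorem aemeasurable_dyadicStep (hU : IsUniform μ s₀ U) (s : ℝ) (a : ℕ → ℝ≥0∞) :
    AEMeasurable (fun x => dyadicStep s a (U x)) μ :=
  ((measurable_dyadicStep s a).comp hU.measurable).aemeasurable

theorem norm_const_mul_dyadicStep (hU : IsUniform μ s₀ U) (X : RISpace μ) (c : ℝ≥0) (s : ℝ)
    (a : ℕ → ℝ≥0∞) : X.norm (fun x => c * dyadicStep s a (U x)) =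
      c * X.norm (fun x => dyadicStep s a (U x)) :=
  X.norm_smul c _ (hU.aemeasurable_dyadicStep s a)

/-- Boundedness of dilation by two. Cutting each dyadic interval in half splits the step function
into two pieces, each equimeasurable with the step function at scale `s₀ / 2`. -/
theorem norm_dyadicStep_le (hU : IsUniform μ s₀ U) (hs₀ : 0 < s₀) (X : RISpace μ)
    (a : ℕ → ℝ≥0∞) :
    X.norm (fun x => dyadicStep s₀ a (U x)) ≤ 2 * X.norm (fun x => dyadicStep (s₀ / 2) a (U x)) := by
  have hs : ∀ k : ℕ, s₀ / 2 ^ k = 2 * (s₀ / 2 ^ (k + 1)) := fun k => by rw [pow_succ]; field_simp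
  have hpos : ∀ k : ℕ, 0 < s₀ / 2 ^ k := fun k => by positivity
  have hle : ∀ k : ℕ, s₀ / 2 ^ k ≤ s₀ := fun k => by
    simpa using dyadic_antitone hs₀.le (Nat.zero_le k)
  let G : ℝ → ℝ → ℝ → ℝ≥0∞ := fun p q s => ∑' k,
    (Ico (p * (s₀ / 2 ^ (k + 1))) (q * (s₀ / 2 ^ (k + 1)))).indicator (fun _ => a k) s
  have hGm : ∀ p q, Measurable (G p q) := fun p q =>
    Measurable.tsum fun _ => measurable_const.indicator measurableSet_Ico
  have hdist : ∀ p q t, 1 ≤ p → q = p + 1 / 2 → q ≤ 2 → μ {x | t < G p q (U x)} =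
      ∑' k : ℕ, if t < a k then ENNReal.ofReal (s₀ / 2 ^ (k + 2)) else 0 := by
    intro p q t hp hpq hq
    refine (hU.measure_lt_step (fun i j hij => ?_) (fun k => ?_) (fun k => ?_) (fun k => ?_) a
      t).trans (tsum_congr fun k => ?_)
    · refine (pairwise_disjoint_dyadic hs₀.le hij).mono (Ico_subset_Ico ?_ ?_)
        (Ico_subset_Ico ?_ ?_)
      · nlinarith [hpos (i + 1)]
      · nlinarith [hpos (i + 1), hs i]
      · nlinarith [hpos (j + 1)]
      · nlinarith [hpos (j + 1), hs j]
    · exact mul_nonneg (by linarith) (hpos _).le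
    · nlinarith [hpos (k + 1)]
    · nlinarith [hpos (k + 1), hs k, hle k]
    · congr 2
      rw [hpq, hs (k + 1)]; ring
  have hdist' : ∀ t, μ {x | t < dyadicStep (s₀ / 2) a (U x)} =
      ∑' k : ℕ, if t < a k then ENNReal.ofReal (s₀ / 2 ^ (k + 2)) else 0 := by
    intro t
    have h2 : (0 : ℝ) ≤ s₀ / 2 := by positivity
    refine (hU.measure_lt_step (pairwise_disjoint_dyadic h2) (fun k => ?_) (fun k => ?_)
      (fun k => ?_) a t).trans (tsum_congr fun k => ?_)
    · positivity
    · exact dyadic_antitone h2 (Nat.le_succ k)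
    · have := dyadic_antitone h2 (Nat.zero_le k)
      simp only [pow_zero, div_one] at this
      linarith
    · congr 2
      rw [pow_succ, pow_add]; field_simp; norm_num
  have hnorm : ∀ p q, 1 ≤ p → q = p + 1 / 2 → q ≤ 2 → X.norm (fun x => G p q (U x)) =
      X.norm (fun x => dyadicStep (s₀ / 2) a (U x)) := fun p q hp hpq hq =>
    X.norm_congr_dist ((hGm p q).comp hU.measurable).aemeasurable
      (hU.aemeasurable_dyadicStep _ _)
      fun t => by rw [hdist p q t hp hpq hq, hdist']
  have hsum : ∀ s, dyadicStep s₀ a s = G 1 (3 / 2) s + G (3 / 2) 2 s := fun s => by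
    simp only [G, dyadicStep]
    rw [← ENNReal.tsum_add]
    refine tsum_congr fun k => ?_
    have hk := hpos (k + 1)
    rw [hs k, one_mul]
    simp only [indicator_apply, mem_Ico]
    split_ifs <;> first | (exfalso; grind) | simp
  simp_rw [hsum]
  refine (X.norm_add_le (fun x => G 1 (3 / 2) (U x)) (fun x => G (3 / 2) 2 (U x)) ((hGm _ _).comp hU.measurable).aemeasurable
    ((hGm _ _).comp hU.measurable).aemeasurable).trans ?_
  rw [hnorm _ _ (by norm_num) (by norm_num) (by norm_num),
    hnorm _ _ (by norm_num) (by norm_num) (by norm_num), two_mul]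

end IsUniform

end StepFunctions

/-! ### Averages over disjoint sets. -/

section Averaging

theorem tsum_indicator_const_eq {ι α : Type*} (A : ι → Set α) (φ : α → ℝ≥0∞) (x : α)
    (hA : Pairwise (Disjoint on A)) :
    ∑' i, (A i).indicator φ x = (⋃ i, A i).indicator φ x := by
  by_cases hx : ∃ i, x ∈ A i
  · obtain ⟨i, hi⟩ := hx
    rw [tsum_indicator_of_mem hA (fun _ => φ) hi, indicator_of_mem (mem_iUnion.2 ⟨i, hi⟩)]
  · rw [indicator_of_notMem (by simpa using hx)]
    push Not at hx
    simp [hx]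

/-- The `m`-th of `n` equal parts of the dyadic interval `[s₀ / 2 ^ (j + 1), s₀ / 2 ^ j)`. -/
def dyadicPart (s₀ : ℝ) (n : ℕ) (p : ℕ × Fin n) : Set ℝ :=
  Ico (s₀ / 2 ^ (p.1 + 1) + p.2 * (s₀ / 2 ^ (p.1 + 1) / n))
    (s₀ / 2 ^ (p.1 + 1) + (p.2 + 1) * (s₀ / 2 ^ (p.1 + 1) / n))

theorem dyadicPart_subset {s₀ : ℝ} (hs₀ : 0 < s₀) {n : ℕ} (p : ℕ × Fin n) :
    dyadicPart s₀ n p ⊆ Ico (s₀ / 2 ^ (p.1 + 1)) (s₀ / 2 ^ p.1) := by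
  have hσ : 0 < s₀ / 2 ^ (p.1 + 1) := by positivity
  have h2 : s₀ / 2 ^ p.1 = s₀ / 2 ^ (p.1 + 1) + s₀ / 2 ^ (p.1 + 1) := by
    rw [pow_succ]; field_simp; norm_num
  have hn : (0 : ℝ) < n := by exact_mod_cast Fin.pos p.2
  refine Ico_subset_Ico (by simp; positivity) ?_
  rw [h2]
  gcongr
  calc (p.2 + 1 : ℝ) * (s₀ / 2 ^ (p.1 + 1) / n) ≤ n * (s₀ / 2 ^ (p.1 + 1) / n) := by
        gcongr; exact_mod_cast p.2.2
    _ = _ := by field_simp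

theorem pairwise_disjoint_dyadicPart {s₀ : ℝ} (hs₀ : 0 < s₀) (n : ℕ) :
    Pairwise (Disjoint on dyadicPart s₀ n) := by
  rintro ⟨j, m⟩ ⟨j', m'⟩ hne
  rcases eq_or_ne j j' with rfl | hj
  · have hσ : 0 ≤ s₀ / 2 ^ (j + 1) / n := by positivity
    have hm : (m : ℕ) ≠ m' := fun h => hne (by rw [Fin.ext h])
    refine disjoint_left.2 fun s hs hs' => ?_
    simp only [dyadicPart, mem_Ico] at hs hs'
    rcases lt_or_gt_of_ne hm with h | h
    · have : ((m : ℕ) + 1 : ℝ) ≤ (m' : ℕ) := by exact_mod_cast h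
      nlinarith [mul_le_mul_of_nonneg_right this hσ]
    · have : ((m' : ℕ) + 1 : ℝ) ≤ (m : ℕ) := by exact_mod_cast h
      nlinarith [mul_le_mul_of_nonneg_right this hσ]
  · exact (pairwise_disjoint_dyadic hs₀.le hj).mono (dyadicPart_subset hs₀ _)
      (dyadicPart_subset hs₀ _)

theorem exists_mem_dyadicPart {s₀ : ℝ} (hs₀ : 0 < s₀) {n : ℕ} (hn : 0 < n) {j : ℕ} {s : ℝ}
    (hs : s ∈ Ico (s₀ / 2 ^ (j + 1)) (s₀ / 2 ^ j)) : ∃ m : Fin n, s ∈ dyadicPart s₀ n (j, m) := by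
  have hn' : (0 : ℝ) < n := by exact_mod_cast hn
  set σ := s₀ / 2 ^ (j + 1) with hσdef
  have hσ : 0 < σ := by positivity
  have h2 : s₀ / 2 ^ j = 2 * σ := by rw [hσdef, pow_succ]; field_simp
  rw [h2] at hs
  have hδ : 0 < σ / n := by positivity
  have h0 : 0 ≤ (s - σ) / (σ / n) := div_nonneg (by linarith [hs.1]) hδ.le
  have hlt : ⌊(s - σ) / (σ / n)⌋₊ < n := by
    rw [Nat.floor_lt h0, div_lt_iff₀ hδ]
    have : n * (σ / n) = σ := by field_simp
    linarith [hs.2]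
  refine ⟨⟨_, hlt⟩, ?_⟩
  have h3 := Nat.floor_le h0
  have h4 := Nat.lt_floor_add_one ((s - σ) / (σ / n))
  rw [le_div_iff₀ hδ] at h3
  rw [div_lt_iff₀ hδ] at h4
  exact ⟨by simp only; linarith, by simp only; linarith⟩

variable {α : Type*} [MeasurableSpace α] {μ : Measure α}

/-- Layer-cake formula on both sides; the bound `L` allows passing to real-valued functions. -/
theorem lintegral_decRearr {f : α → ℝ≥0∞} (hf : AEMeasurable f μ) {L : ℝ≥0}
    (hL : ∀ x, f x ≤ L) : ∫⁻ s in Ioi (0 : ℝ), decRearr μ f s = ∫⁻ x, f x ∂μ := by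
  have hfL : ∀ x, f x ≠ ∞ := fun x => ne_top_of_le_ne_top ENNReal.coe_ne_top (hL x)
  have hrL : ∀ s, decRearr μ f s ≠ ∞ := fun s =>
    ne_top_of_le_ne_top (b := (L : ℝ≥0∞)) ENNReal.coe_ne_top (decRearr_le_iff.2 (by
      simp [not_lt.2 (hL _)]))
  have h1 := lintegral_eq_lintegral_meas_lt μ (f := fun x => (f x).toReal)
    (.of_forall fun x => ENNReal.toReal_nonneg) hf.ennreal_toReal
  have h2 := lintegral_eq_lintegral_meas_lt (volume.restrict (Ioi (0 : ℝ)))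
    (f := fun s => (decRearr μ f s).toReal) (.of_forall fun x => ENNReal.toReal_nonneg)
    (decRearr_antitone f).measurable.aemeasurable.ennreal_toReal
  simp only [ENNReal.ofReal_toReal (hfL _), ENNReal.ofReal_toReal (hrL _)] at h1 h2
  rw [h1, h2]
  refine setLIntegral_congr_fun measurableSet_Ioi fun t ht => ?_
  have ht0 : 0 ≤ t := (mem_Ioi.1 ht).le
  have e1 : {x | t < (f x).toReal} = {x | ENNReal.ofReal t < f x} := by
    ext x; exact (ENNReal.ofReal_lt_iff_lt_toReal ht0 (hfL x)).symm
  have e2 : {s | t < (decRearr μ f s).toReal} =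
      {s | ENNReal.ofReal s < μ {x | ENNReal.ofReal t < f x}} := by
    ext s
    exact (ENNReal.ofReal_lt_iff_lt_toReal ht0 (hrL s)).symm.trans lt_decRearr_iff
  rw [e1, e2, Measure.restrict_apply (measurableSet_lt ENNReal.measurable_ofReal measurable_const)]
  rcases eq_or_ne (μ {x | ENNReal.ofReal t < f x}) ∞ with h | h
  · simp [h]
  · have : {s | ENNReal.ofReal s < μ {x | ENNReal.ofReal t < f x}} ∩ Ioi 0 =
        Ioo 0 (μ {x | ENNReal.ofReal t < f x}).toReal := by
      ext s
      simp only [mem_inter_iff, mem_ofPred_eq, mem_Ioi, mem_Ioo]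
      constructor
      · exact fun ⟨a, b⟩ => ⟨b, (ENNReal.ofReal_lt_iff_lt_toReal b.le h).1 a⟩
      · exact fun ⟨b, a⟩ => ⟨(ENNReal.ofReal_lt_iff_lt_toReal b.le h).2 a, b⟩
    rw [this, Real.volume_Ioo, sub_zero, ENNReal.ofReal_toReal h]

/-- Packing: the parts of length `δ` whose right endpoint lies below `x` fit into `[0, x)`. -/
theorem sum_ite_ofReal_lt_le (δ : ℝ) (x : ℝ≥0∞) (n : ℕ) :
    ∑ m ∈ Finset.range n, (if ENNReal.ofReal ((m + 1) * δ) < x then ENNReal.ofReal δ else 0) ≤ x := by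
  induction n with
  | zero => simp
  | succ n ih =>
    by_cases h : ENNReal.ofReal ((n + 1) * δ) < x
    · calc _ ≤ ∑ m ∈ Finset.range (n + 1), ENNReal.ofReal δ :=
            Finset.sum_le_sum fun m _ => by split_ifs <;> simp
        _ = ENNReal.ofReal ((n + 1) * δ) := by
          rw [Finset.sum_const, Finset.card_range, nsmul_eq_mul,
            ENNReal.ofReal_mul (by positivity)]
          norm_cast
        _ ≤ x := h.le
    · rw [Finset.sum_range_succ, if_neg h, add_zero]; exact ih

/-- The nodes are left endpoints here, but right endpoints of the parts of `[0, n δ)` in the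
averaging argument. Hence `[0, δ)` is dropped; it is recovered by a monotone limit. -/
theorem setLIntegral_Ico_le_sum {f : ℝ → ℝ≥0∞} (hf : Antitone f) (δ : ℝ) (n : ℕ) :
    ∫⁻ s in Ico δ ((n + 1) * δ), f s ≤
      ∑ m ∈ Finset.range n, f ((m + 1) * δ) * ENNReal.ofReal δ := by
  induction n with
  | zero => simp
  | succ n ih =>
    have hsub : Ico δ (((n + 1 : ℕ) + 1) * δ) ⊆
        Ico δ ((n + 1) * δ) ∪ Ico ((n + 1) * δ) ((n + 1) * δ + δ) := by
      intro s hs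
      have h2 : s < (n + 1) * δ + δ := by have := hs.2; push_cast at this; linarith
      rcases lt_or_ge s ((n + 1) * δ) with h | h
      · exact Or.inl ⟨hs.1, h⟩
      · exact Or.inr ⟨h, h2⟩
    rw [Finset.sum_range_succ]
    refine (lintegral_mono_set hsub).trans ((lintegral_union_le _ _ _).trans (add_le_add ih ?_))
    calc ∫⁻ s in Ico ((n + 1) * δ) ((n + 1) * δ + δ), f s
        ≤ ∫⁻ s in Ico ((n + 1) * δ) ((n + 1) * δ + δ), f ((n + 1) * δ) :=
          setLIntegral_mono measurable_const fun s hs => hf hs.1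
      _ = _ := by simp

theorem RISpace.norm_sum_le (X : RISpace μ) {ι : Type*} (S : Finset ι) {F : ι → α → ℝ≥0∞}
    (hF : ∀ i, AEMeasurable (F i) μ) :
    X.norm (fun x => ∑ i ∈ S, F i x) ≤ ∑ i ∈ S, X.norm (F i) := by
  classical
  induction S using Finset.induction_on with
  | empty => simpa using ((X.norm_eq_zero_iff (fun _ => 0) aemeasurable_const).2 (by rfl)).le
  | insert i S hi ih =>
    simp_rw [Finset.sum_insert hi]
    exact (X.norm_add_le _ _ (hF i) (Finset.aemeasurable_fun_sum _ fun i _ => hF i)).trans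
      (add_le_add_right ih _)

namespace IsUniform

variable {s₀ : ℝ} {U : α → ℝ}

/-- The averaged function is the mean of the functions `F i`, which shift the sampled rearrangement
values cyclically among the equal parts of each dyadic interval. Sampling a decreasing function at
right endpoints only lowers the distribution, so each `F i` has norm at most that of `φ`; the
triangle inequality concludes. -/
theorem norm_step_average_le (hU : IsUniform μ s₀ U) (hs₀ : 0 < s₀) (X : RISpace μ)
    {φ : α → ℝ≥0∞} (hφ : Measurable φ) {A : ℕ → Set α} (hA : Pairwise (Disjoint on A))
    (hAm : ∀ j, MeasurableSet (A j)) (hAle : ∀ j, μ (A j) ≤ ENNReal.ofReal (s₀ / 2 ^ (j + 1)))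
    (n : ℕ) :
    X.norm (fun x => dyadicStep s₀ (fun j => ((n + 1 : ℕ) : ℝ≥0∞)⁻¹ *
      ∑ m : Fin (n + 1), decRearr μ ((A j).indicator φ)
        (((m : ℕ) + 1) * (s₀ / 2 ^ (j + 1) / (n + 1 : ℕ)))) (U x)) ≤ X.norm φ := by
  set N := n + 1 with hN
  have hN0 : ((N : ℕ) : ℝ≥0∞) ≠ 0 := by simp [hN]
  have hNt : ((N : ℕ) : ℝ≥0∞) ≠ ∞ := ENNReal.natCast_ne_top N
  have hNpos : (0 : ℝ) < N := by rw [hN]; positivity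
  let c : ℕ → Fin N → ℝ≥0∞ := fun j m => decRearr μ ((A j).indicator φ)
    (((m : ℕ) + 1) * (s₀ / 2 ^ (j + 1) / N))
  let F : Fin N → ℝ → ℝ≥0∞ := fun i s =>
    ∑' p : ℕ × Fin N, (dyadicPart s₀ N p).indicator (fun _ => c p.1 (i + p.2)) s
  have hFm : ∀ i, Measurable (F i) := fun i =>
    Measurable.tsum fun _ => measurable_const.indicator measurableSet_Ico
  have hF : ∀ i, X.norm (fun x => F i (U x)) ≤ X.norm φ := by
    intro i
    have hψ : ∀ t, μ {x | t < (⋃ j, A j).indicator φ x} = ∑' j, μ {x | t < (A j).indicator φ x} := by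
      intro t
      simp_rw [← tsum_indicator_const_eq A φ _ hA]
      rw [measure_lt_tsum_indicator hA hAm (fun _ => hφ)]
      refine tsum_congr fun j => congrArg μ ?_
      ext x
      by_cases hx : x ∈ A j <;> simp [hx]
    have h0 : μ {x | 0 < (⋃ j, A j).indicator φ x} ≤ ENNReal.ofReal s₀ := by
      rw [hψ, ← tsum_ofReal_dyadic hs₀.le]
      refine ENNReal.tsum_le_tsum fun j => (measure_mono fun x hx => ?_).trans (hAle j)
      by_contra h
      simp [h] at hx
    refine (hU.norm_le_of_dist_le X (hφ.indicator (MeasurableSet.iUnion hAm)).aemeasurable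
      ((hFm i).comp hU.measurable).aemeasurable h0 hs₀.le fun t => ?_).trans
      (X.norm_mono _ _ (hφ.indicator (MeasurableSet.iUnion hAm)).aemeasurable hφ.aemeasurable
        (.of_forall fun x => indicator_le_self _ _ x))
    rw [hψ]
    have hstep := hU.measure_lt_step (pairwise_disjoint_dyadicPart hs₀ N)
      (fun p => by positivity) (fun p => by gcongr; linarith) (fun p => ?_)
      (fun p => c p.1 (i + p.2)) t
    · refine Eq.trans_le hstep ?_
      rw [ENNReal.tsum_prod']
      refine ENNReal.tsum_le_tsum fun j => ?_
      rw [tsum_fintype]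
      have hperm : ∑ m, (if t < c j (i + m) then ENNReal.ofReal (s₀ / 2 ^ (j + 1) / N) else 0) =
          ∑ m, if t < c j m then ENNReal.ofReal (s₀ / 2 ^ (j + 1) / N) else 0 :=
        Equiv.sum_comp (Equiv.addLeft i)
          (fun m => if t < c j m then ENNReal.ofReal (s₀ / 2 ^ (j + 1) / N) else 0)
      have hlen : ∀ m : Fin N, s₀ / 2 ^ (j + 1) + ((m : ℕ) + 1) * (s₀ / 2 ^ (j + 1) / N) -
          (s₀ / 2 ^ (j + 1) + (m : ℕ) * (s₀ / 2 ^ (j + 1) / N)) = s₀ / 2 ^ (j + 1) / N :=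
        fun m => by ring
      simp only [hlen]
      rw [hperm]
      simp only [c, lt_decRearr_iff]
      rw [Fin.sum_univ_eq_sum_range (fun m => if ENNReal.ofReal (((m : ℕ) + 1) *
        (s₀ / 2 ^ (j + 1) / N)) < μ {x | t < (A j).indicator φ x} then ENNReal.ofReal
        (s₀ / 2 ^ (j + 1) / N) else 0)]
      exact sum_ite_ofReal_lt_le _ _ _
    · have hmem := dyadicPart_subset hs₀ p
      have hle := dyadic_antitone hs₀.le (Nat.zero_le p.1)
      simp only [pow_zero, div_one] at hle
      have hlt : s₀ / 2 ^ (p.1 + 1) + p.2 * (s₀ / 2 ^ (p.1 + 1) / N) <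
          s₀ / 2 ^ (p.1 + 1) + (p.2 + 1) * (s₀ / 2 ^ (p.1 + 1) / N) := by
        gcongr; linarith
      exact ((Ico_subset_Ico_iff hlt).1 hmem).2.trans hle
  have hNN : ((N : ℝ≥0)⁻¹ : ℝ≥0) = ((N : ℕ) : ℝ≥0∞)⁻¹ := by
    rw [ENNReal.coe_inv (by simp [hN])]; simp
  calc _ ≤ X.norm (fun x => ((N : ℝ≥0)⁻¹ : ℝ≥0) * ∑ i : Fin N, F i (U x)) := by
        refine X.norm_mono _ _ (hU.aemeasurable_dyadicStep _ _)
          ((Finset.measurable_fun_sum _ fun i _ => (hFm i).comp hU.measurable).const_mul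
            _).aemeasurable (.of_forall fun x => ?_)
        dsimp only
        generalize U x = s
        rcases dyadicStep_cases hs₀ s with hs | ⟨j, hs⟩
        · rw [hs]; exact zero_le
        rw [dyadicStep_of_mem hs₀.le _ hs, hNN]
        obtain ⟨m, hm⟩ := exists_mem_dyadicPart hs₀ (n := N) (by omega) hs
        refine mul_le_mul_right (Eq.le ?_) _
        -- On a fixed part, running through all shifts visits every sample once.
        rw [← Equiv.sum_comp (Equiv.addRight m)]
        refine Finset.sum_congr rfl fun i _ => ?_
        exact (tsum_indicator_of_mem (pairwise_disjoint_dyadicPart hs₀ N)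
          (fun p _ => c p.1 (i + p.2)) hm).symm
    _ = ((N : ℝ≥0)⁻¹ : ℝ≥0) * X.norm (fun x => ∑ i : Fin N, F i (U x)) :=
        X.norm_smul _ _ (Finset.measurable_fun_sum _ fun i _ =>
          (hFm i).comp hU.measurable).aemeasurable
    _ ≤ ((N : ℝ≥0)⁻¹ : ℝ≥0) * ∑ i : Fin N, X.norm φ := by
        gcongr
        exact (X.norm_sum_le _ fun i => ((hFm i).comp hU.measurable).aemeasurable).trans
          (Finset.sum_le_sum fun i _ => hF i)
    _ = X.norm φ := by
        rw [hNN, Finset.sum_const, Finset.card_univ, Fintype.card_fin, nsmul_eq_mul, ← mul_assoc,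
          ENNReal.inv_mul_cancel hN0 hNt, one_mul]

/-- Averaging over disjoint sets is a contraction on rearrangement invariant spaces. -/
theorem norm_dyadicStep_average_le (hU : IsUniform μ s₀ U) (hs₀ : 0 < s₀) (X : RISpace μ)
    {φ : α → ℝ≥0∞} (hφ : Measurable φ) {L : ℝ≥0} (hL : ∀ x, φ x ≤ L) {A : ℕ → Set α}
    (hA : Pairwise (Disjoint on A)) (hAm : ∀ j, MeasurableSet (A j))
    (hAle : ∀ j, μ (A j) ≤ ENNReal.ofReal (s₀ / 2 ^ (j + 1))) :
    X.norm (fun x => dyadicStep s₀ (fun j => (ENNReal.ofReal (s₀ / 2 ^ (j + 1)))⁻¹ *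
      ∫⁻ x in A j, φ x ∂μ) (U x)) ≤ X.norm φ := by
  let σ : ℕ → ℝ := fun j => s₀ / 2 ^ (j + 1)
  have hσ : ∀ j, 0 < σ j := fun j => by simp only [σ]; positivity
  let ρ : ℕ → ℝ → ℝ≥0∞ := fun j => decRearr μ ((A j).indicator φ)
  have hρ : ∀ j, Antitone (ρ j) := fun j => decRearr_antitone _
  -- These truncated integrals are dominated by the Riemann sums and increase to the full integrals,
  -- so the Fatou property finishes the proof.
  let I : ℕ → ℕ → ℝ≥0∞ := fun n j => ∫⁻ s in Ico (σ j / (n + 1 : ℕ)) (σ j), ρ j s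
  have hImono : ∀ j, Monotone fun n => I n j := fun j n m hnm => by
    refine lintegral_mono_set (Ico_subset_Ico_left ?_)
    have := hσ j
    gcongr
  have hIsup : ∀ j, ⨆ n, I n j = ∫⁻ x in A j, φ x ∂μ := by
    intro j
    have hun : ⋃ n : ℕ, Ico (σ j / (n + 1 : ℕ)) (σ j) = Ioo 0 (σ j) := by
      ext s
      simp only [mem_iUnion, mem_Ico, mem_Ioo]
      constructor
      · rintro ⟨n, h1, h2⟩
        exact ⟨lt_of_lt_of_le (div_pos (hσ j) (by positivity)) h1, h2⟩
      · rintro ⟨h1, h2⟩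
        obtain ⟨n, hn⟩ := exists_nat_gt (σ j / s)
        refine ⟨n, ?_, h2⟩
        rw [div_lt_iff₀ h1] at hn
        rw [div_le_iff₀ (by positivity)]
        push_cast
        nlinarith
    have hdir : Monotone fun n : ℕ => Ico (σ j / (n + 1 : ℕ)) (σ j) := fun n m hnm => by
      refine Ico_subset_Ico_left ?_
      have := hσ j
      gcongr
    have h1 : ⨆ n, I n j = ∫⁻ s in Ioo 0 (σ j), ρ j s := by
      rw [← hun, setLIntegral_iUnion_of_directed _ hdir.directed_le]
    rw [h1, ← lintegral_indicator (hAm j), ← lintegral_decRearr (L := L)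
      (hφ.indicator (hAm j)).aemeasurable (fun x => (indicator_le_self _ _ x).trans (hL x)),
      ← Ioo_union_Ici_eq_Ioi (hσ j), lintegral_union measurableSet_Ici
        (disjoint_left.2 fun s hs hs' => not_lt.2 hs' hs.2),
      setLIntegral_congr_fun (g := fun _ => 0) measurableSet_Ici fun s hs => ?_]
    · simp [ρ]
    · refine nonpos_iff_eq_zero.1 (decRearr_le_iff.2 ?_)
      refine ((measure_mono fun x hx => ?_).trans (hAle j)).trans (ENNReal.ofReal_le_ofReal hs)
      by_contra h
      simp [h] at hx
  have hle : ∀ n, X.norm (fun x => dyadicStep s₀ (fun j => (ENNReal.ofReal (σ j))⁻¹ * I n j) (U x)) ≤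
      X.norm φ := by
    intro n
    refine (X.norm_mono _ _ (hU.aemeasurable_dyadicStep _ _)
      (hU.aemeasurable_dyadicStep _ _)
      (.of_forall fun x => dyadicStep_mono _ (fun j => ?_) _)).trans
      (hU.norm_step_average_le hs₀ X hφ hA hAm hAle n)
    have hN : (0 : ℝ) < (n + 1 : ℕ) := by positivity
    have h1 := setLIntegral_Ico_le_sum (hρ j) (σ j / (n + 1 : ℕ)) (n + 1)
    have h2 : I n j ≤ ∑ m ∈ Finset.range (n + 1), ρ j ((m + 1) * (σ j / (n + 1 : ℕ))) *
        ENNReal.ofReal (σ j / (n + 1 : ℕ)) := by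
      refine le_trans (lintegral_mono_set (Ico_subset_Ico_right ?_)) h1
      have h3 : ((n + 1 : ℕ) : ℝ) * (σ j / (n + 1 : ℕ)) = σ j := by field_simp
      rw [add_mul, h3, one_mul]
      linarith [div_pos (hσ j) hN]
    rw [← Finset.sum_mul, ENNReal.ofReal_div_of_pos hN, ENNReal.ofReal_natCast] at h2
    rw [Fin.sum_univ_eq_sum_range (fun m => decRearr μ ((A j).indicator φ)
        (((m : ℕ) + 1) * (s₀ / 2 ^ (j + 1) / (n + 1 : ℕ))))]
    have hσ0 : ENNReal.ofReal (σ j) ≠ 0 := by simpa using hσ j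
    calc (ENNReal.ofReal (σ j))⁻¹ * I n j ≤ (ENNReal.ofReal (σ j))⁻¹ *
          ((∑ m ∈ Finset.range (n + 1), ρ j ((m + 1) * (σ j / (n + 1 : ℕ)))) *
            (ENNReal.ofReal (σ j) / (n + 1 : ℕ))) := by gcongr
      _ = ((ENNReal.ofReal (σ j))⁻¹ * ENNReal.ofReal (σ j)) * (((n + 1 : ℕ) : ℝ≥0∞)⁻¹ *
          ∑ m ∈ Finset.range (n + 1), ρ j ((m + 1) * (σ j / (n + 1 : ℕ)))) := by
        generalize ∑ m ∈ Finset.range (n + 1), ρ j ((m + 1) * (σ j / (n + 1 : ℕ))) = S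
        rw [div_eq_mul_inv]
        ring
      _ = _ := by rw [ENNReal.inv_mul_cancel hσ0 ENNReal.ofReal_ne_top, one_mul]
  have hfat := X.fatou (fun n x => dyadicStep s₀ (fun j => (ENNReal.ofReal (σ j))⁻¹ * I n j) (U x))
    (fun n => (hU.aemeasurable_dyadicStep _ _))
    (.of_forall fun x n m hnm => dyadicStep_mono _ (fun j => by gcongr; exact hImono j hnm) _)
  have heq : ∀ s, dyadicStep s₀ (fun j => (ENNReal.ofReal (σ j))⁻¹ * ∫⁻ x in A j, φ x ∂μ) s =
      ⨆ n, dyadicStep s₀ (fun j => (ENNReal.ofReal (σ j))⁻¹ * I n j) s := fun s => by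
    rcases dyadicStep_cases hs₀ s with hs | ⟨j, hs⟩
    · simp [hs]
    simp_rw [dyadicStep_of_mem hs₀.le _ hs]
    rw [← hIsup, ENNReal.mul_iSup]
  calc _ = X.norm (fun x => ⨆ n, dyadicStep s₀ (fun j => (ENNReal.ofReal (σ j))⁻¹ * I n j) (U x)) := by
        congr 1; funext x; exact heq _
    _ ≤ X.norm φ := by rw [hfat]; exact iSup_le hle

end IsUniform

end Averaging

/-! ### The coarea inequality. -/

section Coarea

variable {Ω : Type*} [MetricSpace Ω]

/-- The supremum of the slopes `|f(x) - f(y)| / d(x, y)` over `0 < d(x, y) < r`. -/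
def slopeSup (f : Ω → ℝ) (r : ℝ) (x : Ω) : ℝ≥0∞ :=
  ⨆ (y : Ω) (_ : y ∈ Metric.ball x r ∩ {x}ᶜ), ENNReal.ofReal |f x - f y| / edist x y

theorem slopeSup_mono (f : Ω → ℝ) (x : Ω) : Monotone fun r => slopeSup f r x := fun _ _ h =>
  biSup_mono fun _ hy => ⟨Metric.ball_subset_ball h hy.1, hy.2⟩

theorem gradModulus_eq_iInf (f : Ω → ℝ) {r₀ : ℝ} (hr₀ : 0 < r₀) (x : Ω) :
    gradModulus f x = ⨅ n : ℕ, slopeSup f (r₀ / (n + 1)) x := by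
  rw [gradModulus, (Metric.nhdsWithin_basis_ball (s := {x}ᶜ) (x := x)).limsup_eq_iInf_iSup]
  refine le_antisymm (le_iInf fun n => iInf₂_le _ (by positivity)) (le_iInf₂ fun ε hε => ?_)
  obtain ⟨n, hn⟩ := exists_nat_gt (r₀ / ε)
  refine (iInf_le _ n).trans (slopeSup_mono f x ?_)
  rw [div_lt_iff₀ hε] at hn
  rw [div_le_iff₀ (by positivity)]
  nlinarith

theorem slopeSup_le {f : Ω → ℝ} {L : ℝ≥0} (hf : LipschitzWith L f) (r : ℝ) (x : Ω) :
    slopeSup f r x ≤ L := by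
  refine iSup₂_le fun y _ => ENNReal.div_le_of_le_mul ?_
  rw [← Real.dist_eq, ← edist_dist]
  exact hf x y

theorem gradModulus_le {f : Ω → ℝ} {L : ℝ≥0} (hf : LipschitzWith L f) (x : Ω) :
    gradModulus f x ≤ L := by
  rw [gradModulus_eq_iInf f one_pos]
  exact (iInf_le _ 0).trans (slopeSup_le hf _ x)

/-- The set is a union over `y` of open sets, since each difference quotient is continuous away from
`y`. Openness makes the uncountable union harmless for measurability. -/
theorem isOpen_lt_slopeSup {f : Ω → ℝ} (hf : Continuous f) (r : ℝ) (t : ℝ≥0∞) :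
    IsOpen {x | t < slopeSup f r x} := by
  have : {x | t < slopeSup f r x} = ⋃ y, (Metric.ball y r ∩ {y}ᶜ) ∩
      (fun x => ENNReal.ofReal |f x - f y| / edist x y) ⁻¹' Ioi t := by
    ext x
    simp only [slopeSup, mem_ofPred_eq, lt_iSup_iff, mem_iUnion, mem_inter_iff, mem_preimage,
      mem_Ioi, Metric.mem_ball, mem_compl_iff, mem_singleton_iff, exists_prop, dist_comm x,
      eq_comm (a := x)]
  rw [this]
  refine isOpen_iUnion fun y => ContinuousOn.isOpen_inter_preimage (fun x hx => ?_)
    (Metric.isOpen_ball.inter isOpen_compl_singleton) isOpen_Ioi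
  have h1 : ContinuousAt (fun x => ENNReal.ofReal |f x - f y|) x :=
    ENNReal.continuous_ofReal.continuousAt.comp (by fun_prop)
  have h2 : ContinuousAt (fun x => edist x y) x := by fun_prop
  have h3 : ContinuousAt (fun x => ENNReal.ofReal |f x - f y| / edist x y) x :=
    ENNReal.Tendsto.div h1 (Or.inr (by simpa using hx.2)) h2 (Or.inr ENNReal.ofReal_ne_top)
  exact h3.continuousWithinAt

variable [MeasurableSpace Ω] [BorelSpace Ω]

theorem measurable_slopeSup {f : Ω → ℝ} (hf : Continuous f) (r : ℝ) :
    Measurable (slopeSup f r) :=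
  measurable_of_Ioi fun t => (isOpen_lt_slopeSup hf r t).measurableSet

theorem measurable_gradModulus {f : Ω → ℝ} (hf : Continuous f) : Measurable (gradModulus f) := by
  rw [funext (gradModulus_eq_iInf f one_pos)]
  exact Measurable.iInf fun n => measurable_slopeSup hf _

/-- Joint measurability in the point and the level, as required by Tonelli. -/
theorem measurableSet_thickening_hypograph {f : Ω → ℝ} (hf : Continuous f) (h a b : ℝ) :
    MeasurableSet {p : Ω × ℝ | p.2 ∈ Ioo a b ∧
      p.1 ∈ Metric.thickening h {x | p.2 < f x} \ {x | p.2 < f x}} := by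
  have h1 : IsOpen {p : Ω × ℝ | p.1 ∈ Metric.thickening h {x | p.2 < f x}} := by
    have : {p : Ω × ℝ | p.1 ∈ Metric.thickening h {x | p.2 < f x}} =
        ⋃ y, {p : Ω × ℝ | p.2 < f y ∧ dist p.1 y < h} := by
      ext p; simp [Metric.mem_thickening_iff]
    rw [this]
    refine isOpen_iUnion fun y => IsOpen.and ?_ ?_
    · exact isOpen_lt continuous_snd continuous_const
    · exact isOpen_lt (by fun_prop) continuous_const
  have h2 : IsOpen {p : Ω × ℝ | p.2 < f p.1} := isOpen_lt continuous_snd (by fun_prop)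
  exact (measurable_snd measurableSet_Ioo).inter (h1.measurableSet.diff h2.measurableSet)

variable {μ : Measure Ω} [SigmaFinite μ]

theorem measurable_measure_thickening_sdiff {f : Ω → ℝ} (hf : Continuous f) (h a b : ℝ) :
    Measurable fun t => (Ioo a b).indicator
      (fun t => μ (Metric.thickening h {x | t < f x} \ {x | t < f x})) t := by
  convert measurable_measure_prodMk_right (μ := μ) (measurableSet_thickening_hypograph hf h a b)
    using 2 with t
  by_cases ht : t ∈ Ioo a b
  · rw [indicator_of_mem ht]
    congr 1; ext x; simp [ht.1, ht.2]
  · rw [indicator_of_notMem ht]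
    symm
    convert measure_empty (μ := μ)
    ext x
    simp only [mem_preimage, mem_ofPred_eq, ht, false_and, mem_empty_iff_false]

/-- By Tonelli: a point `x` lies in the shell of level `t` only if `f x ≤ t < f x + h * slopeSup f h
x`. The margin `a' - a` absorbs the oscillation `L * h` and forces `a < f x`. -/
theorem lintegral_measure_thickening_sdiff_le {f : Ω → ℝ} {L : ℝ≥0} (hf : LipschitzWith L f)
    {a a' b h : ℝ} (hL : L * h ≤ a' - a) :
    ∫⁻ t in Ioo a' b, μ (Metric.thickening h {x | t < f x} \ {x | t < f x}) ≤
      ∫⁻ x in {x | a < f x ∧ f x < b}, ENNReal.ofReal h * slopeSup f h x ∂μ := by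
  have hZ := measurableSet_thickening_hypograph hf.continuous h a' b
  have hA : MeasurableSet {x | a < f x ∧ f x < b} :=
    hf.continuous.measurable measurableSet_Ioo
  calc ∫⁻ t in Ioo a' b, μ (Metric.thickening h {x | t < f x} \ {x | t < f x})
      = ∫⁻ t, μ ((fun x => (x, t)) ⁻¹' {p : Ω × ℝ | p.2 ∈ Ioo a' b ∧
          p.1 ∈ Metric.thickening h {x | p.2 < f x} \ {x | p.2 < f x}}) := by
        rw [← lintegral_indicator measurableSet_Ioo]
        refine lintegral_congr fun t => ?_
        by_cases ht : t ∈ Ioo a' b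
        · rw [indicator_of_mem ht]
          congr 1; ext x; simp [ht.1, ht.2]
        · rw [indicator_of_notMem ht]
          symm
          convert measure_empty (μ := μ)
          ext x
          simp only [mem_preimage, mem_ofPred_eq, ht, false_and, mem_empty_iff_false]
    _ = ∫⁻ x, volume (Prod.mk x ⁻¹' {p : Ω × ℝ | p.2 ∈ Ioo a' b ∧
          p.1 ∈ Metric.thickening h {x | p.2 < f x} \ {x | p.2 < f x}}) ∂μ := by
        rw [← Measure.prod_apply_symm hZ, Measure.prod_apply hZ]
    _ ≤ ∫⁻ x, {x | a < f x ∧ f x < b}.indicator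
          (fun x => ENNReal.ofReal h * slopeSup f h x) x ∂μ := by
        refine lintegral_mono fun x => ?_
        have key : ∀ t ∈ Prod.mk x ⁻¹' {p : Ω × ℝ | p.2 ∈ Ioo a' b ∧
            p.1 ∈ Metric.thickening h {x | p.2 < f x} \ {x | p.2 < f x}},
            (a < f x ∧ f x < b) ∧
              t ∈ Ico (f x) (f x + (ENNReal.ofReal h * slopeSup f h x).toReal) := by
          rintro t ⟨⟨ht1, ht2⟩, hT, hS⟩
          obtain ⟨y, hy, hxy⟩ := Metric.mem_thickening_iff.1 hT
          simp only [mem_ofPred_eq, not_lt] at ht1 ht2 hS hy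
          have hne : x ≠ y := fun e => by rw [e] at hS; linarith
          have hlip := hf.dist_le_mul x y
          rw [Real.dist_eq] at hlip
          have habs := neg_abs_le (f x - f y)
          refine ⟨⟨?_, by linarith⟩, hS, ?_⟩
          · nlinarith [mul_le_mul_of_nonneg_left hxy.le L.2]
          · have hs : ENNReal.ofReal |f x - f y| ≤ ENNReal.ofReal h * slopeSup f h x := by
              have h1 : ENNReal.ofReal |f x - f y| / edist x y ≤ slopeSup f h x :=
                le_iSup₂_of_le y ⟨by rwa [Metric.mem_ball, dist_comm], by simpa using hne.symm⟩ le_rfl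
              rw [ENNReal.div_le_iff (by simpa using hne) (edist_ne_top x y)] at h1
              rw [mul_comm]
              refine h1.trans ?_
              gcongr
              rw [edist_dist]
              exact ENNReal.ofReal_le_ofReal hxy.le
            have hfin : ENNReal.ofReal h * slopeSup f h x ≠ ∞ :=
              ENNReal.mul_ne_top ENNReal.ofReal_ne_top
                (ne_top_of_le_ne_top ENNReal.coe_ne_top (slopeSup_le hf h x))
            have := (ENNReal.ofReal_le_iff_le_toReal hfin).1 hs
            linarith
        by_cases hx : x ∈ {x | a < f x ∧ f x < b}
        · rw [indicator_of_mem hx]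
          refine (measure_mono fun t ht => (key t ht).2).trans ?_
          rw [Real.volume_Ico, add_sub_cancel_left]
          exact ENNReal.ofReal_toReal_le
        · refine le_trans (Eq.le ?_) zero_le
          convert measure_empty (μ := volume)
          exact eq_empty_of_forall_notMem fun t ht => hx (key t ht).1
    _ = _ := lintegral_indicator hA _

/-- A co-area inequality for the Minkowski content of superlevel sets. -/
theorem mul_le_lintegral_gradModulus {f : Ω → ℝ} {L : ℝ≥0} (hf : LipschitzWith L f) {a b : ℝ}
    (hfin : μ {x | a < f x} ≠ ∞) {I₀ : ℝ≥0∞}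
    (hI : ∀ t, a < t → t < b → I₀ ≤ perimeter μ {x | t < f x}) :
    ENNReal.ofReal (b - a) * I₀ ≤ ∫⁻ x in {x | a < f x ∧ f x < b}, gradModulus f x ∂μ := by
  set A := {x | a < f x ∧ f x < b} with hAdef
  have hAfin : μ A ≠ ∞ := ne_top_of_le_ne_top hfin (measure_mono fun x hx => hx.1)
  have main : ∀ ε > 0, ENNReal.ofReal (b - (a + ε)) * I₀ ≤ ∫⁻ x in A, gradModulus f x ∂μ := by
    intro ε hε
    -- `L * h₀ ≤ ε` supplies the margin of the shell estimate; the `+ 1` covers `L = 0`.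
    set h₀ := ε / (L + 1) with hh₀
    have hh₀pos : 0 < h₀ := by positivity
    let h : ℕ → ℝ := fun n => h₀ / (n + 1)
    have hpos : ∀ n, 0 < h n := fun n => by positivity
    have hlim : Tendsto h atTop (𝓝[>] 0) := by
      refine tendsto_nhdsWithin_iff.2 ⟨?_, .of_forall hpos⟩
      have := tendsto_one_div_add_atTop_nhds_zero_nat.const_mul h₀
      simpa [h, div_eq_mul_inv] using this
    have hle : ∀ n, h n ≤ h₀ := fun n => div_le_self hh₀pos.le (by linarith [n.cast_nonneg (α := ℝ)])
    have hL : ∀ n, L * h n ≤ a + ε - a := fun n => by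
      have : (L + 1) * h₀ = ε := by rw [hh₀]; field_simp
      nlinarith [hle n, L.2, mul_le_mul_of_nonneg_left (hle n) L.2]
    let D : ℕ → ℝ → ℝ≥0∞ := fun n t => (Ioo (a + ε) b).indicator
      (fun t => μ (Metric.thickening (h n) {x | t < f x} \ {x | t < f x})) t / ENNReal.ofReal (h n)
    have hDm : ∀ n, Measurable (D n) := fun n =>
      (measurable_measure_thickening_sdiff hf.continuous (h n) (a + ε) b).div_const _
    have h1 : ∀ t ∈ Ioo (a + ε) b, I₀ ≤ liminf (fun n => D n t) atTop := by
      intro t ht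
      refine (hI t (by linarith [ht.1]) ht.2).trans ?_
      calc perimeter μ {x | t < f x}
          ≤ liminf (fun n => (μ (Metric.thickening (h n) {x | t < f x}) - μ {x | t < f x}) /
              ENNReal.ofReal (h n)) atTop :=
            liminf_le_liminf_of_le hlim
        _ ≤ _ := by
            refine liminf_le_liminf (.of_forall fun n => ?_)
            simp only [D, indicator_of_mem ht]
            gcongr
            exact le_measure_sdiff
    have h2 : ∀ n, ∫⁻ t in Ioo (a + ε) b, D n t ≤ ∫⁻ x in A, slopeSup f (h n) x ∂μ := by
      intro n
      have hn0 : ENNReal.ofReal (h n) ≠ 0 := by simpa using hpos n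
      simp only [D, div_eq_mul_inv]
      rw [lintegral_mul_const _
        (measurable_measure_thickening_sdiff hf.continuous (h n) (a + ε) b),
        setLIntegral_congr_fun measurableSet_Ioo fun t ht => indicator_of_mem ht _,
        ← div_eq_mul_inv]
      refine ENNReal.div_le_of_le_mul ?_
      refine (lintegral_measure_thickening_sdiff_le hf (hL n)).trans ?_
      rw [lintegral_const_mul _ (measurable_slopeSup hf.continuous _), mul_comm]
    have hanti : Antitone fun n => slopeSup f (h n) := fun m n hmn x => by
      refine slopeSup_mono f x ?_
      simp only [h]
      gcongr
    have hanti' : Antitone fun n => ∫⁻ x in A, slopeSup f (h n) x ∂μ := fun m n hmn =>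
      lintegral_mono (hanti hmn)
    -- Fatou in the level, then decreasing convergence of the slopes to `gradModulus f`, allowed
    -- because they are at most `L` on a set of finite measure.
    calc ENNReal.ofReal (b - (a + ε)) * I₀ = ∫⁻ t in Ioo (a + ε) b, I₀ := by
          simp [mul_comm]
      _ ≤ ∫⁻ t in Ioo (a + ε) b, liminf (fun n => D n t) atTop :=
          setLIntegral_mono' measurableSet_Ioo h1
      _ ≤ liminf (fun n => ∫⁻ t in Ioo (a + ε) b, D n t) atTop := lintegral_liminf_le hDm
      _ ≤ liminf (fun n => ∫⁻ x in A, slopeSup f (h n) x ∂μ) atTop :=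
          liminf_le_liminf (.of_forall h2)
      _ = ⨅ n, ∫⁻ x in A, slopeSup f (h n) x ∂μ := (tendsto_atTop_iInf hanti').liminf_eq
      _ = ∫⁻ x in A, ⨅ n, slopeSup f (h n) x ∂μ := by
          refine (lintegral_iInf (fun n => measurable_slopeSup hf.continuous _) hanti
            (ne_top_of_le_ne_top ?_ (lintegral_mono (slopeSup_le hf _)))).symm
          simpa using ENNReal.mul_ne_top ENNReal.coe_ne_top hAfin
      _ = _ := lintegral_congr fun x => (gradModulus_eq_iInf f hh₀pos x).symm
  rcases eq_or_ne I₀ ∞ with rfl | hI₀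
  · rcases le_or_gt b a with hab | hab
    · simp [ENNReal.ofReal_of_nonpos (sub_nonpos.2 hab)]
    · have := main ((b - a) / 2) (by linarith)
      rw [ENNReal.mul_top (by simp; linarith)] at this
      exact le_top.trans this
  · have hlim : Tendsto (fun n : ℕ => ENNReal.ofReal (b - (a + 1 / ((n : ℝ) + 1))) * I₀) atTop
        (𝓝 (ENNReal.ofReal (b - (a + 0)) * I₀)) :=
      ENNReal.Tendsto.mul_const (ENNReal.tendsto_ofReal
        ((tendsto_one_div_add_atTop_nhds_zero_nat.const_add a).const_sub b)) (Or.inr hI₀)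
    rw [add_zero] at hlim
    exact le_of_tendsto' hlim fun n => main _ (by positivity)

end Coarea

/-! ### Consequences of concavity of the profile. -/

section Profile

theorem ofReal_lt_measure_univ_of_le_half {α : Type*} [MeasurableSpace α] {μ : Measure α}
    (hμ : μ univ ≠ 0) {t : ℝ} (ht : ENNReal.ofReal t ≤ μ univ / 2) : ENNReal.ofReal t < μ univ := by
  rcases eq_or_ne (μ univ) ∞ with h | h
  · rw [h]; exact ENNReal.ofReal_lt_top
  · exact ht.trans_lt (ENNReal.half_lt_self hμ h)

variable {Ω : Type*} [MetricSpace Ω] [MeasurableSpace Ω] {μ : Measure Ω}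

/-- Concavity with `I(0) = 0` makes `I(t)/t` non-increasing; the product form avoids dividing by
zero. -/
theorem AdmissibleProfile.mul_le_mul (hI : AdmissibleProfile μ) {s t : ℝ} (hs : 0 ≤ s)
    (hst : s ≤ t) (ht : ENNReal.ofReal t < μ univ) :
    ENNReal.ofReal s * isoProfile μ (ENNReal.ofReal t) ≤
      ENNReal.ofReal t * isoProfile μ (ENNReal.ofReal s) := by
  rcases (hs.trans hst).eq_or_lt with h0 | h0
  · rw [← h0] at hst
    simp [le_antisymm hst hs]
  have hm : ∀ u, 0 ≤ u → u ≤ t → u ∈ profileDomain μ := fun u hu hut =>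
    ⟨hu, (ENNReal.ofReal_le_ofReal hut).trans_lt ht⟩
  have hsf := hI.finite s (hm s hs hst)
  have htf := hI.finite t (hm t h0.le le_rfl)
  have hst1 : s / t ≤ 1 := (div_le_one h0).2 hst
  have key := hI.concave.2 (hm 0 le_rfl h0.le) (hm t h0.le le_rfl)
    (show 0 ≤ 1 - s / t by linarith) (show 0 ≤ s / t by positivity) (by ring)
  have e : (1 - s / t) • (0 : ℝ) + (s / t) • t = s := by simp; field_simp
  rw [e] at key
  simp only [ENNReal.ofReal_zero, hI.zero, ENNReal.toReal_zero, smul_eq_mul, mul_zero,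
    zero_add] at key
  rw [div_mul_eq_mul_div, div_le_iff₀ h0] at key
  rw [← ENNReal.ofReal_toReal hsf.ne, ← ENNReal.ofReal_toReal htf.ne, ← ENNReal.ofReal_mul hs,
    ← ENNReal.ofReal_mul h0.le]
  exact ENNReal.ofReal_le_ofReal (by linarith)

theorem AdmissibleProfile.div_le_div (hI : AdmissibleProfile μ) {s t : ℝ} (hs : 0 < s)
    (hst : s ≤ t) (ht : ENNReal.ofReal t < μ univ) :
    isoProfile μ (ENNReal.ofReal t) / ENNReal.ofReal t ≤
      isoProfile μ (ENNReal.ofReal s) / ENNReal.ofReal s := by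
  have ht0 := hs.trans_le hst
  rw [ENNReal.div_le_iff (by simpa using ht0) ENNReal.ofReal_ne_top, mul_comm, ← mul_div_assoc,
    ENNReal.le_div_iff_mul_le (Or.inl (by simpa using hs)) (Or.inl ENNReal.ofReal_ne_top), mul_comm]
  exact hI.mul_le_mul hs.le hst ht

/-- For finite measure, `t` lies between `s` and `μ(Ω) - s`, where the profile takes equal values by
symmetry; concavity concludes. -/
theorem AdmissibleProfile.mono (hI : AdmissibleProfile μ) (hμ : μ univ ≠ 0) {s t : ℝ}
    (hs : 0 ≤ s) (hst : s ≤ t) (ht : ENNReal.ofReal t ≤ μ univ / 2) :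
    isoProfile μ (ENNReal.ofReal s) ≤ isoProfile μ (ENNReal.ofReal t) := by
  rcases eq_or_ne (μ univ) ∞ with h | h
  · exact hI.increasing h _ _ (ENNReal.ofReal_le_ofReal hst) ENNReal.ofReal_lt_top
  rcases hs.eq_or_lt with rfl | hs
  · simp [hI.zero]
  set M := (μ univ).toReal with hM
  have hMe : μ univ = ENNReal.ofReal M := (ENNReal.ofReal_toReal h).symm
  have hM0 : 0 < M := ENNReal.toReal_pos hμ h
  have ht2 : t ≤ M / 2 := by
    rw [hMe, ← ENNReal.ofReal_ofNat 2, ← ENNReal.ofReal_div_of_pos two_pos,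
      ENNReal.ofReal_le_ofReal_iff (by positivity)] at ht
    exact ht
  have hm : ∀ u, 0 ≤ u → u < M → u ∈ profileDomain μ := fun u hu huM =>
    ⟨hu, by rw [hMe]; exact (ENNReal.ofReal_lt_ofReal_iff hM0).2 huM⟩
  have hsM : s < M := by linarith
  have hsym : isoProfile μ (ENNReal.ofReal (M - s)) = isoProfile μ (ENNReal.ofReal s) := by
    rw [hI.symmetric h.lt_top (ENNReal.ofReal s) (by simpa using hs) (hm s hs.le hsM).2, hMe,
      ENNReal.ofReal_sub _ hs.le]
  have key := hI.concave.ge_on_segment (hm s hs.le hsM) (hm (M - s) (by linarith) (by linarith))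
    (z := t) (by rw [segment_eq_Icc (by linarith)]; exact ⟨hst, by linarith⟩)
  simp only [hsym, min_self] at key
  exact (ENNReal.toReal_le_toReal (hI.finite s (hm s hs.le hsM)).ne
    (hI.finite t (hm t (by linarith) (by linarith))).ne).1 key

theorem AdmissibleProfile.div_le_isoPhi (hI : AdmissibleProfile μ) (hμ : μ univ ≠ 0) {s : ℝ}
    (hs : 0 < s) {m : ℝ≥0∞} (hsm : ENNReal.ofReal s ≤ m) (hs2 : ENNReal.ofReal s ≤ μ univ / 2) :
    ENNReal.ofReal s / isoProfile μ (ENNReal.ofReal s) ≤ isoPhi μ m := by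
  unfold isoPhi
  split_ifs with hm
  · exact le_iSup₂_of_le (ENNReal.ofReal s) ENNReal.ofReal_lt_top le_rfl
  · have hτ : min m (μ univ / 2) ≠ ∞ := ne_top_of_le_ne_top hm (min_le_left _ _)
    obtain ⟨τ, hτ0, hτe⟩ : ∃ τ : ℝ, 0 ≤ τ ∧ min m (μ univ / 2) = ENNReal.ofReal τ :=
      ⟨_, ENNReal.toReal_nonneg, (ENNReal.ofReal_toReal hτ).symm⟩
    have hsτ : s ≤ τ := (ENNReal.ofReal_le_ofReal_iff hτ0).1 (hτe ▸ le_min hsm hs2)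
    have hτ2 : ENNReal.ofReal τ ≤ μ univ / 2 := hτe ▸ min_le_right _ _
    have hτM := ofReal_lt_measure_univ_of_le_half hμ hτ2
    rw [hτe]
    have h := hI.div_le_div hs hsτ hτM
    rw [← ENNReal.inv_le_inv, ENNReal.inv_div (Or.inl ENNReal.ofReal_ne_top)
      (Or.inl (by simpa using hs)), ENNReal.inv_div (Or.inl ENNReal.ofReal_ne_top)
      (Or.inl (by simpa using hs.trans_le hsτ))] at h
    exact h

/-- A single zero makes the profile vanish on all of `(0, μ(Ω)/2]`, so `Φ = ∞` at positive
arguments. The growth condition then makes every `{w ≤ r}` null, although these sets exhaust `Ω`. -/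
theorem AdmissibleProfile.ne_zero (hI : AdmissibleProfile μ) (hμ : μ univ ≠ 0) {w : Ω → ℝ}
    (hw : IsIsoperimetricWeight μ w) {t : ℝ} (ht : 0 < t)
    (ht2 : ENNReal.ofReal t ≤ μ univ / 2) : isoProfile μ (ENNReal.ofReal t) ≠ 0 := by
  intro h0
  have hall : ∀ s, 0 < s → ENNReal.ofReal s ≤ μ univ / 2 →
      isoProfile μ (ENNReal.ofReal s) = 0 := by
    intro s hs hs2
    rcases le_total s t with h | h
    · exact nonpos_iff_eq_zero.1 (h0 ▸ hI.mono hμ hs.le h ht2)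
    · have := hI.mul_le_mul ht.le h (ofReal_lt_measure_univ_of_le_half hμ hs2)
      rw [h0, mul_zero, nonpos_iff_eq_zero, mul_eq_zero] at this
      exact this.resolve_left (by simpa using ht)
  obtain ⟨C, hC, hg⟩ := hw.growth
  have hnull : ∀ r : ℝ, 0 < r → μ {x | w x ≤ r} = 0 := by
    intro r hr
    by_contra hne
    have hpos : 0 < min (μ {x | w x ≤ r}) (μ univ / 2) :=
      lt_min (pos_iff_ne_zero.2 hne) (ENNReal.half_pos hμ)
    obtain ⟨s, -, hs0, hs⟩ := ENNReal.lt_iff_exists_real_btwn.1 hpos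
    have hs0 : 0 < s := by simpa using hs0
    have hs2 := hs.le.trans (min_le_right _ _)
    have := (hI.div_le_isoPhi hμ hs0 (hs.le.trans (min_le_left _ _)) hs2).trans (hg r hr)
    rw [hall s hs0 hs2, ENNReal.div_zero (by simpa using hs0)] at this
    exact ENNReal.ofReal_ne_top (top_le_iff.1 this)
  refine hμ ?_
  have : (univ : Set Ω) = ⋃ n : ℕ, {x | w x ≤ n + 1} := by
    ext x
    simp only [mem_univ, mem_iUnion, true_iff]
    obtain ⟨n, hn⟩ := exists_nat_gt (w x)
    exact ⟨n, by simp only [mem_ofPred_eq]; linarith⟩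
  rw [this]
  exact measure_iUnion_null fun n => hnull _ (by positivity)

end Profile

/-! ### Transfer to the representation space. -/

section BarNorm

namespace IsUniform

variable {α : Type*} [MeasurableSpace α] {μ : Measure α} {s₀ : ℝ} {U : α → ℝ}

theorem aemeasurable_comp (hU : IsUniform μ s₀ U) (hs₀ : 0 ≤ s₀) {q : ℝ → ℝ≥0∞}
    (hq : AEMeasurable q (volume.restrict (Ico 0 s₀))) (hq0 : ∀ s, s₀ ≤ s → q s = 0) :
    AEMeasurable (fun x => q (U x)) μ := by
  have hS : MeasurableSet (U ⁻¹' Ico 0 s₀) := hU.measurable measurableSet_Ico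
  have h1 : AEMeasurable (fun x => q (U x)) (μ.restrict (U ⁻¹' Ico 0 s₀)) := by
    rw [← hU.map_restrict hs₀] at hq
    exact hq.comp_measurable hU.measurable
  have h2 : (fun x => q (U x)) = (U ⁻¹' Ico 0 s₀).indicator (fun x => q (U x)) := by
    ext x
    by_cases hx : U x < s₀
    · rw [indicator_of_mem (show x ∈ U ⁻¹' Ico 0 s₀ from ⟨hU.nonneg x, hx⟩)]
    · rw [indicator_of_notMem (fun h => hx h.2), hq0 _ (not_lt.1 hx)]
  rw [h2]
  exact (aemeasurable_indicator_iff hS).2 h1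

theorem decRearr_comp (hU : IsUniform μ s₀ U) (hs₀ : 0 < s₀) (hle : ENNReal.ofReal s₀ ≤ μ univ)
    {q : ℝ → ℝ≥0∞} (hq : AEMeasurable q (volume.restrict (Ico 0 s₀)))
    (hq0 : ∀ s, s₀ ≤ s → q s = 0) :
    decRearr μ (fun x => q (U x)) = decRearr (lebesgueOn (μ univ)) q := by
  refine decRearr_eq_of_dist_eq fun t => ?_
  have hS : MeasurableSet (U ⁻¹' Ico 0 s₀) := hU.measurable measurableSet_Ico
  have hmp : MeasurePreserving U (μ.restrict (U ⁻¹' Ico 0 s₀)) (volume.restrict (Ico 0 s₀)) :=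
    ⟨hU.measurable, hU.map_restrict hs₀.le⟩
  have hD : MeasurableSet {s : ℝ | 0 < s ∧ ENNReal.ofReal s < μ univ} :=
    measurableSet_Ioi.inter (measurableSet_lt ENNReal.measurable_ofReal measurable_const)
  have h1 : μ {x | t < q (U x)} = volume ({s | t < q s} ∩ Ico 0 s₀) := by
    have := hmp.measure_preimage (hq.nullMeasurableSet_preimage (measurableSet_Ioi (a := t)))
    rw [Measure.restrict_apply' measurableSet_Ico, Measure.restrict_apply' hS] at this
    refine Eq.trans (congrArg μ ?_) this
    ext x
    refine ⟨fun hx => ⟨hx, hU.nonneg x, ?_⟩, fun hx => hx.1⟩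
    by_contra h
    simp only [mem_ofPred_eq, hq0 _ (not_lt.1 h)] at hx
    exact not_lt_zero hx
  rw [h1, lebesgueOn, Measure.restrict_apply' hD]
  refine le_antisymm ?_ (measure_mono fun s hs => ⟨hs.1, hs.2.1.le, ?_⟩)
  · have : {s | t < q s} ∩ Ico 0 s₀ ⊆
        ({s | t < q s} ∩ {s : ℝ | 0 < s ∧ ENNReal.ofReal s < μ univ}) ∪ {0} := by
      rintro s ⟨hs, hs0, hss⟩
      rcases hs0.eq_or_lt with h | h
      · exact Or.inr h.symm
      · exact Or.inl ⟨hs, h, ((ENNReal.ofReal_lt_ofReal_iff hs₀).2 hss).trans_le hle⟩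
    refine (measure_mono this).trans ((measure_union_le _ _).trans ?_)
    simp
  · by_contra h
    have h2 := hs.1
    simp only [mem_ofPred_eq, hq0 _ (not_lt.1 h)] at h2
    exact not_lt_zero h2

/-- By rearrangement invariance all competitors in the supremum defining `barNorm` have the same
norm, and `q ∘ U` is one of them. -/
theorem norm_comp_eq_barNorm (hU : IsUniform μ s₀ U) (hs₀ : 0 < s₀)
    (hle : ENNReal.ofReal s₀ ≤ μ univ) (X : RISpace μ) {q : ℝ → ℝ≥0∞}
    (hq : AEMeasurable q (volume.restrict (Ico 0 s₀))) (hq0 : ∀ s, s₀ ≤ s → q s = 0) :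
    X.norm (fun x => q (U x)) = X.barNorm q := by
  have hm := hU.aemeasurable_comp hs₀.le hq hq0
  have hr := hU.decRearr_comp hs₀ hle hq hq0
  refine le_antisymm (le_iSup_of_le _ (le_iSup₂_of_le hm hr le_rfl)) ?_
  refine iSup_le fun g => iSup₂_le fun hg hgr => ?_
  exact (X.rearrangement_invariant _ _ hg hm (hgr.trans hr.symm)).le

end IsUniform

end BarNorm

/-! ### The isoperimetric Hardy operator on step functions. -/

section Hardy

variable {Ω : Type*} [MetricSpace Ω] [MeasurableSpace Ω] {μ : Measure Ω} {s₀ : ℝ} {U : Ω → ℝ}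

theorem isoHardy_of_le {h : ℝ → ℝ≥0∞} (hh : ∀ s, s₀ ≤ s → h s = 0) {t : ℝ} (ht : s₀ ≤ t) :
    isoHardy μ h t = 0 := by
  have hm : MeasurableSet {s : ℝ | t < s ∧ ENNReal.ofReal s < μ univ / 2} :=
    measurableSet_Ioi.inter (measurableSet_lt ENNReal.measurable_ofReal measurable_const)
  rw [isoHardy, setLIntegral_congr_fun (g := fun _ => 0) hm fun s hs => by
    rw [hh s (ht.trans hs.1.le), ENNReal.zero_div]]
  simp

/-- On `(0, s₀)` both factors are non-increasing, whatever `h` is. -/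
theorem AdmissibleProfile.aemeasurable_isoHardy (hI : AdmissibleProfile μ)
    (hlt : ENNReal.ofReal s₀ < μ univ) (h : ℝ → ℝ≥0∞) :
    AEMeasurable (isoHardy μ h) (volume.restrict (Ico 0 s₀)) := by
  rw [← Measure.restrict_congr_set Ioo_ae_eq_Ico]
  refine aemeasurable_restrict_of_antitoneOn measurableSet_Ioo fun s hs t ht hst => ?_
  refine mul_le_mul' (hI.div_le_div hs.1 hst
    ((ENNReal.ofReal_le_ofReal ht.2.le).trans_lt hlt)) (lintegral_mono_set fun u hu => ?_)
  exact ⟨hst.trans_lt hu.1, hu.2⟩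

/-- A discrete lower bound for the isoperimetric Hardy operator. -/
theorem IsUniform.norm_dyadicStep_le_of_hardy (hU : IsUniform μ s₀ U) (hs₀ : 0 < s₀)
    (hI : AdmissibleProfile μ) (hμ : μ univ ≠ 0) (hs2 : ENNReal.ofReal s₀ ≤ μ univ / 2)
    (X : RISpace μ) {K : ℝ≥0} (hK : ∀ h : ℝ → ℝ≥0∞, AEMeasurable h (lebesgueOn (μ univ)) →
      X.barNorm (isoHardy μ h) ≤ K * X.barNorm h) (a b : ℕ → ℝ≥0∞)
    (hb : ∀ k, b k ≤ ∫⁻ s in Ico (s₀ / 2 ^ (k + 1)) s₀,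
      dyadicStep s₀ a s / isoProfile μ (ENNReal.ofReal s)) :
    X.norm (fun x => dyadicStep s₀ (fun k => b k * (isoProfile μ (ENNReal.ofReal (s₀ / 2 ^ (k + 1)))
      / ENNReal.ofReal (s₀ / 2 ^ (k + 1)))) (U x)) ≤
      2 * K * X.norm (fun x => dyadicStep s₀ a (U x)) := by
  have hlt := ofReal_lt_measure_univ_of_le_half hμ hs2
  have hm := hI.aemeasurable_isoHardy hlt (dyadicStep s₀ a)
  have h0 : ∀ s, s₀ ≤ s → dyadicStep s₀ a s = 0 := fun s => dyadicStep_of_le hs₀.le a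
  have hq0 : ∀ s, s₀ ≤ s → isoHardy μ (dyadicStep s₀ a) s = 0 := fun s => isoHardy_of_le h0
  rw [mul_assoc]
  -- At scale `s₀ / 2` the `k`-th value sits on an interval entirely to the left of `[s₀ / 2 ^ (k +
  -- 1), s₀)`, so at each of its points the Hardy integral contains the whole integral bounding `b
  -- k`. This costs the factor `2`.
  refine (hU.norm_dyadicStep_le hs₀ X _).trans (mul_le_mul_right ?_ _)
  rw [hU.norm_comp_eq_barNorm hs₀ hlt.le X (measurable_dyadicStep _ _).aemeasurable h0]
  refine le_trans ?_ (hK _ (measurable_dyadicStep _ _).aemeasurable)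
  rw [← hU.norm_comp_eq_barNorm hs₀ hlt.le X hm hq0]
  refine X.norm_mono _ _ (hU.aemeasurable_dyadicStep _ _)
    (hU.aemeasurable_comp hs₀.le hm hq0) (.of_forall fun x => ?_)
  dsimp only
  generalize U x = s
  have hh0 : 0 < s₀ / 2 := by positivity
  rcases dyadicStep_cases hh0 s with hs | ⟨k, hs⟩
  · rw [hs]; exact zero_le
  rw [dyadicStep_of_mem hh0.le _ hs, isoHardy, mul_comm]
  have hk : s₀ / 2 / 2 ^ k = s₀ / 2 ^ (k + 1) := by rw [pow_succ]; field_simp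
  rw [hk] at hs
  have hspos : 0 < s := lt_of_lt_of_le (by positivity) hs.1
  have hkle : s₀ / 2 ^ (k + 1) ≤ s₀ := by
    simpa using dyadic_antitone hs₀.le (Nat.zero_le (k + 1))
  refine mul_le_mul' (hI.div_le_div hspos hs.2.le
    ((ENNReal.ofReal_le_ofReal hkle).trans_lt hlt)) ((hb k).trans (lintegral_mono_set fun u hu => ?_))
  exact ⟨hs.2.trans_le hu.1, ((ENNReal.ofReal_lt_ofReal_iff hs₀).2 hu.2).trans_le hs2⟩

end Hardy

/-! ### Localization and the Sobolev inequality for rearrangements. -/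

section Core

theorem ofReal_dyadic_le_half {α : Type*} [MeasurableSpace α] {μ : Measure α} {s₀ : ℝ}
    (hs₀ : 0 ≤ s₀) (hs2 : ENNReal.ofReal s₀ ≤ μ univ / 2) (k : ℕ) :
    ENNReal.ofReal (s₀ / 2 ^ k) ≤ μ univ / 2 := by
  refine (ENNReal.ofReal_le_ofReal ?_).trans hs2
  simpa using dyadic_antitone hs₀ (Nat.zero_le k)

/-- The lower bound may fail at the level `b` itself, so the layer is exhausted by levels increasing
to `b`. -/
theorem measure_between_le {α : Type*} [MeasurableSpace α] {μ : Measure α} {f : α → ℝ}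
    (hf : Measurable f) {a b s : ℝ} (hs : 0 ≤ s)
    (ha : μ {x | a < f x} ≤ ENNReal.ofReal (2 * s))
    (hb : ∀ t, a < t → t < b → ENNReal.ofReal s ≤ μ {x | t < f x}) :
    μ {x | a < f x ∧ f x < b} ≤ ENNReal.ofReal s := by
  rcases le_or_gt b a with hab | hab
  · have : {x | a < f x ∧ f x < b} = ∅ := by
      ext x; simp only [mem_ofPred_eq, mem_empty_iff_false, iff_false]; rintro ⟨h1, h2⟩; linarith
    simp [this]
  obtain ⟨t, htm, ht, hlim⟩ := exists_seq_strictMono_tendsto' hab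
  have hun : {x | a < f x ∧ f x < b} ⊆ ⋃ n, {x | a < f x ∧ f x ≤ t n} := by
    rintro x ⟨h1, h2⟩
    obtain ⟨n, hn⟩ := ((tendsto_order.1 hlim).1 _ h2).exists
    exact mem_iUnion.2 ⟨n, h1, hn.le⟩
  have hmono : Monotone fun n => {x | a < f x ∧ f x ≤ t n} := fun m n hmn x hx =>
    ⟨hx.1, hx.2.trans (htm.monotone hmn)⟩
  refine (measure_mono hun).trans ?_
  rw [hmono.measure_iUnion]
  refine iSup_le fun n => ?_
  have hsub : {x | t n < f x} ⊆ {x | a < f x} := fun x hx => (ht n).1.trans hx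
  have heq : {x | a < f x ∧ f x ≤ t n} = {x | a < f x} \ {x | t n < f x} := by
    ext x; simp
  rw [heq, measure_sdiff hsub (measurableSet_lt measurable_const hf).nullMeasurableSet
    (ne_top_of_le_ne_top ENNReal.ofReal_ne_top ((measure_mono hsub).trans ha))]
  refine tsub_le_iff_right.2 (ha.trans ?_)
  rw [two_mul, ENNReal.ofReal_add hs hs]
  gcongr
  exact hb _ (ht n).1 (ht n).2

variable {Ω : Type*} [MetricSpace Ω] [MeasurableSpace Ω] {μ : Measure Ω} {s₀ : ℝ} {U : Ω → ℝ}

/-- On `[σ, 2σ)` one has `I(s) ≤ 2 I(σ)`, as `I(s)/s` is non-increasing; the factors `σ` and `I(σ)`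
then cancel. -/
theorem half_le_setLIntegral_dyadic (hI : AdmissibleProfile μ) (hμ : μ univ ≠ 0)
    (hs2 : ENNReal.ofReal s₀ ≤ μ univ / 2) (hs₀ : 0 < s₀)
    (hI0 : ∀ t, 0 < t → ENNReal.ofReal t ≤ μ univ / 2 → isoProfile μ (ENNReal.ofReal t) ≠ 0)
    (d : ℕ → ℝ≥0∞) (j : ℕ) :
    d j / 2 ≤ ∫⁻ s in Ico (s₀ / 2 ^ (j + 1)) (s₀ / 2 ^ j), dyadicStep s₀
      (fun k => (ENNReal.ofReal (s₀ / 2 ^ (k + 1)))⁻¹ *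
        (d k * isoProfile μ (ENNReal.ofReal (s₀ / 2 ^ (k + 1))))) s /
      isoProfile μ (ENNReal.ofReal s) := by
  set σ := s₀ / 2 ^ (j + 1) with hσdef
  have hσ : 0 < σ := by positivity
  have h2 : s₀ / 2 ^ j = 2 * σ := by rw [hσdef, pow_succ]; field_simp
  have hσ2 : ENNReal.ofReal σ ≤ μ univ / 2 := ofReal_dyadic_le_half hs₀.le hs2 _
  have hσ0 : ENNReal.ofReal σ ≠ 0 := by simpa using hσ
  have hσt : ENNReal.ofReal σ ≠ ∞ := ENNReal.ofReal_ne_top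
  have hIf := (hI.finite σ ⟨hσ.le, ofReal_lt_measure_univ_of_le_half hμ hσ2⟩).ne
  have hIz := hI0 σ hσ hσ2
  set I := isoProfile μ (ENNReal.ofReal σ) with hIdef
  have hle : ∀ s ∈ Ico σ (s₀ / 2 ^ j), (ENNReal.ofReal σ)⁻¹ * (d j * I) / (2 * I) ≤ dyadicStep s₀
      (fun k => (ENNReal.ofReal (s₀ / 2 ^ (k + 1)))⁻¹ *
        (d k * isoProfile μ (ENNReal.ofReal (s₀ / 2 ^ (k + 1))))) s /
      isoProfile μ (ENNReal.ofReal s) := by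
    intro s hs
    rw [dyadicStep_of_mem hs₀.le _ hs]
    refine ENNReal.div_le_div_left ?_ _
    have hsl : ENNReal.ofReal s < μ univ := (ENNReal.ofReal_le_ofReal hs.2.le).trans_lt
      (ofReal_lt_measure_univ_of_le_half hμ (ofReal_dyadic_le_half hs₀.le hs2 _))
    have h3 := hI.mul_le_mul hσ.le hs.1 hsl
    have h4 : ENNReal.ofReal s ≤ ENNReal.ofReal σ * 2 := by
      rw [← ENNReal.ofReal_ofNat 2, ← ENNReal.ofReal_mul hσ.le]
      exact ENNReal.ofReal_le_ofReal (by linarith [hs.2])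
    have h5 := h3.trans (mul_le_mul_left h4 I)
    rw [mul_assoc] at h5
    exact (ENNReal.mul_le_mul_iff_right hσ0 hσt).1 h5
  calc d j / 2 = ∫⁻ s in Ico σ (s₀ / 2 ^ j), (ENNReal.ofReal σ)⁻¹ * (d j * I) / (2 * I) := by
        rw [setLIntegral_const, Real.volume_Ico, h2, show 2 * σ - σ = σ by ring,
          ENNReal.div_eq_inv_mul, ENNReal.div_eq_inv_mul,
          ENNReal.mul_inv (Or.inl two_ne_zero) (Or.inl ENNReal.ofNat_ne_top)]
        calc 2⁻¹ * d j = 2⁻¹ * d j * (I⁻¹ * I) * ((ENNReal.ofReal σ)⁻¹ * ENNReal.ofReal σ) := by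
              rw [ENNReal.inv_mul_cancel hIz hIf, ENNReal.inv_mul_cancel hσ0 hσt, mul_one, mul_one]
          _ = _ := by ring
    _ ≤ _ := setLIntegral_mono' measurableSet_Ico hle

/-- Localization to sets on which the weight is small. -/
theorem IsUniform.norm_indicator_le (hU : IsUniform μ s₀ U) (hs₀ : 0 < s₀)
    (hI : AdmissibleProfile μ) (hμ : μ univ ≠ 0) (hs2 : ENNReal.ofReal s₀ ≤ μ univ / 2)
    (hI0 : ∀ t, 0 < t → ENNReal.ofReal t ≤ μ univ / 2 → isoProfile μ (ENNReal.ofReal t) ≠ 0)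
    (X : RISpace μ) {u : Ω → ℝ≥0∞} (hu : AEMeasurable u μ) {W : Set Ω}
    (hW : NullMeasurableSet W μ) (hu0 : μ {x | 0 < u x} ≤ ENNReal.ofReal s₀) {Λ : ℝ≥0}
    (hΛ : isoPhi μ (μ W) ≤ Λ) {v : ℕ → ℝ≥0∞}
    (hv : ∀ k, decRearr μ u (s₀ / 2 ^ (k + 1)) ≤ v k) :
    X.norm (W.indicator u) ≤ Λ * X.norm (fun x => dyadicStep s₀
      (fun k => v k * (isoProfile μ (ENNReal.ofReal (s₀ / 2 ^ (k + 1))) /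
        ENNReal.ofReal (s₀ / 2 ^ (k + 1)))) (U x)) := by
  have hWu : AEMeasurable (W.indicator u) μ := hu.indicator₀ hW
  have hsub : ∀ t, {x | t < W.indicator u x} ⊆ {x | t < u x} := fun t x (hx : t < W.indicator u x) =>
    hx.trans_le (indicator_le_self _ _ x)
  have hWu0 : μ {x | 0 < W.indicator u x} ≤ ENNReal.ofReal s₀ := (measure_mono (hsub 0)).trans hu0
  have hWu1 : μ {x | 0 < W.indicator u x} ≤ μ W := measure_mono fun x hx => by
    by_contra h
    simp [h] at hx
  rw [← hU.norm_const_mul_dyadicStep X,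
    ← hU.norm_decRearr_comp X hWu hWu0 hs₀.le]
  refine X.norm_mono _ _ ((decRearr_antitone _).measurable.comp hU.measurable).aemeasurable
    ((hU.aemeasurable_dyadicStep _ _).const_mul _) ?_
  filter_upwards [hU.ae_pos hs₀] with x hx
  generalize U x = s at hx
  rcases le_or_gt s₀ s with hs | hs
  · refine le_trans (decRearr_le_iff.2 (hWu0.trans (ENNReal.ofReal_le_ofReal hs))) zero_le
  obtain ⟨k, hk⟩ := exists_mem_dyadic hx hs
  rw [dyadicStep_of_mem hs₀.le _ hk]
  rcases le_or_gt (μ W) (ENNReal.ofReal s) with hsW | hsW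
  · exact le_trans (decRearr_le_iff.2 (hWu1.trans hsW)) zero_le
  set σ := s₀ / 2 ^ (k + 1) with hσdef
  have hσ : 0 < σ := by positivity
  have hσ2 : ENNReal.ofReal σ ≤ μ univ / 2 := ofReal_dyadic_le_half hs₀.le hs2 _
  have hσ0 : ENNReal.ofReal σ ≠ 0 := by simpa using hσ
  have hIf := (hI.finite σ ⟨hσ.le, ofReal_lt_measure_univ_of_le_half hμ hσ2⟩).ne
  -- Here `σ ≤ s < μ W`, so `σ/I(σ) ≤ Φ(μ W) ≤ Λ`.
  have h1 : 1 ≤ Λ * (isoProfile μ (ENNReal.ofReal σ) / ENNReal.ofReal σ) := by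
    have h := (hI.div_le_isoPhi hμ hσ ((ENNReal.ofReal_le_ofReal hk.1).trans hsW.le) hσ2).trans hΛ
    rw [ENNReal.div_le_iff (hI0 σ hσ hσ2) hIf] at h
    rw [← mul_div_assoc, ENNReal.le_div_iff_mul_le (Or.inl hσ0) (Or.inl ENNReal.ofReal_ne_top),
      one_mul]
    exact h
  calc decRearr μ (W.indicator u) s ≤ decRearr μ u s :=
        decRearr_le_of_dist_le (fun t => measure_mono (hsub t)) s
    _ ≤ v k := (decRearr_antitone u hk.1).trans (hv k)
    _ ≤ v k * (Λ * (isoProfile μ (ENNReal.ofReal σ) / ENNReal.ofReal σ)) := le_mul_of_one_le_right' h1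
    _ = _ := by ring

variable [BorelSpace Ω] [SigmaFinite μ]

/-- The superlevel sets in the layer have measure between `s` and `s₀ ≤ μ(Ω)/2`, where the profile
increases; hence `I(s)` bounds all their perimeters from below. -/
theorem isoProfile_mul_le_lintegral (hI : AdmissibleProfile μ) (hμ : μ univ ≠ 0)
    (hs2 : ENNReal.ofReal s₀ ≤ μ univ / 2) {f : Ω → ℝ} {L : ℝ≥0}
    (hf : LipschitzWith L f) (hf0 : μ {x | 0 < f x} ≤ ENNReal.ofReal s₀) {a b s : ℝ} (ha : 0 ≤ a)
    (hs : 0 ≤ s) (hb : ∀ t, a < t → t < b → ENNReal.ofReal s ≤ μ {x | t < f x}) :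
    ENNReal.ofReal (b - a) * isoProfile μ (ENNReal.ofReal s) ≤
      ∫⁻ x in {x | a < f x ∧ f x < b}, gradModulus f x ∂μ := by
  have hmle : ∀ t, 0 ≤ t → μ {x | t < f x} ≤ ENNReal.ofReal s₀ := fun t ht =>
    (measure_mono (show {x | t < f x} ⊆ {x | 0 < f x} from fun x hx => ht.trans_lt hx)).trans hf0
  refine mul_le_lintegral_gradModulus hf
    (ne_top_of_le_ne_top ENNReal.ofReal_ne_top (hmle a ha)) fun t hat htb => ?_
  have hm := hmle t (ha.trans hat.le)
  have hmt : μ {x | t < f x} ≠ ∞ := ne_top_of_le_ne_top ENNReal.ofReal_ne_top hm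
  have hsm := hb t hat htb
  have hle : isoProfile μ (ENNReal.ofReal s) ≤ isoProfile μ (μ {x | t < f x}) := by
    rw [← ENNReal.ofReal_toReal hmt] at hsm ⊢
    refine hI.mono hμ hs ((ENNReal.ofReal_le_ofReal_iff ENNReal.toReal_nonneg).1 hsm) ?_
    rw [ENNReal.ofReal_toReal hmt]
    exact hm.trans hs2
  have hmeas : MeasurableSet {x | t < f x} :=
    measurableSet_lt measurable_const hf.continuous.measurable
  exact hle.trans (iInf_le_of_le _ (iInf_le_of_le hmeas (iInf_le_of_le rfl le_rfl)))

/-- The rearrangement form of the isoperimetric Sobolev inequality. -/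
theorem IsUniform.norm_rearrangement_le_gradModulus (hU : IsUniform μ s₀ U) (hs₀ : 0 < s₀)
    (hI : AdmissibleProfile μ) (hμ : μ univ ≠ 0) (hs2 : ENNReal.ofReal s₀ ≤ μ univ / 2)
    (hI0 : ∀ t, 0 < t → ENNReal.ofReal t ≤ μ univ / 2 → isoProfile μ (ENNReal.ofReal t) ≠ 0)
    (X : RISpace μ) {K : ℝ≥0} (hK : ∀ h : ℝ → ℝ≥0∞, AEMeasurable h (lebesgueOn (μ univ)) →
      X.barNorm (isoHardy μ h) ≤ K * X.barNorm h) {f : Ω → ℝ} {L : ℝ≥0}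
    (hf : LipschitzWith L f) {B : ℝ} (hB : ∀ x, f x ≤ B)
    (hf0 : μ {x | 0 < f x} ≤ ENNReal.ofReal s₀) :
    X.norm (fun x => dyadicStep s₀
      (fun k => decRearr μ (fun x => ENNReal.ofReal (f x)) (s₀ / 2 ^ (k + 1)) *
        (isoProfile μ (ENNReal.ofReal (s₀ / 2 ^ (k + 1))) /
          ENNReal.ofReal (s₀ / 2 ^ (k + 1)))) (U x)) ≤ 4 * K * X.norm (gradModulus f) := by
  let u : Ω → ℝ≥0∞ := fun x => ENNReal.ofReal (f x)
  let v : ℕ → ℝ≥0∞ := fun k => decRearr μ u (s₀ / 2 ^ k)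
  have hlevel : ∀ t, 0 ≤ t → {x | ENNReal.ofReal t < u x} = {x | t < f x} := fun t ht => by
    ext x; exact ENNReal.ofReal_lt_ofReal_iff_of_nonneg ht
  have hvt : ∀ k, v k ≠ ∞ := fun k => by
    refine ne_top_of_le_ne_top (b := ENNReal.ofReal B) ENNReal.ofReal_ne_top (decRearr_le_iff.2 ?_)
    simp [u, not_lt.2 (ENNReal.ofReal_le_ofReal (hB _))]
  let V : ℕ → ℝ := fun k => (v k).toReal
  have hV0 : ∀ k, 0 ≤ V k := fun k => ENNReal.toReal_nonneg
  have hvV : ∀ k, v k = ENNReal.ofReal (V k) := fun k => (ENNReal.ofReal_toReal (hvt k)).symm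
  have hv0 : v 0 = 0 := by
    refine nonpos_iff_eq_zero.1 (decRearr_le_iff.2 ?_)
    rw [pow_zero, div_one]
    simpa [u] using hf0
  have hVmono : Monotone V := fun j k hjk =>
    ENNReal.toReal_mono (hvt k) (decRearr_antitone u (dyadic_antitone hs₀.le hjk))
  have hV1 : ∀ k, μ {x | V k < f x} ≤ ENNReal.ofReal (2 * (s₀ / 2 ^ (k + 1))) := fun k => by
    rw [← hlevel _ (hV0 k), ← hvV]
    refine (decRearr_le_iff.1 le_rfl).trans (ENNReal.ofReal_le_ofReal (Eq.le ?_))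
    rw [pow_succ]; field_simp
  have hV2 : ∀ k t, V k < t → t < V (k + 1) →
      ENNReal.ofReal (s₀ / 2 ^ (k + 1)) ≤ μ {x | t < f x} := fun k t h1 h2 => by
    have ht0 := (hV0 k).trans h1.le
    rw [← hlevel t ht0]
    refine (lt_decRearr_iff.1 ?_).le
    change _ < v (k + 1)
    rw [hvV]
    exact (ENNReal.ofReal_lt_ofReal_iff_of_nonneg ht0).2 h2
  let A : ℕ → Set Ω := fun k => {x | V k < f x ∧ f x < V (k + 1)}
  let d : ℕ → ℝ≥0∞ := fun k => ENNReal.ofReal (V (k + 1) - V k)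
  -- By coarea, `a k` is at most `(s₀ / 2 ^ (k + 1))⁻¹` times the integral of the gradient over `A
  -- k`.
  let a : ℕ → ℝ≥0∞ := fun k => (ENNReal.ofReal (s₀ / 2 ^ (k + 1)))⁻¹ *
    (d k * isoProfile μ (ENNReal.ofReal (s₀ / 2 ^ (k + 1))))
  have hσ : ∀ k, (0 : ℝ) ≤ s₀ / 2 ^ k := fun k => by positivity
  have hgrad : X.norm (fun x => dyadicStep s₀ a (U x)) ≤ X.norm (gradModulus f) := by
    refine le_trans (X.norm_mono _ _ (hU.aemeasurable_dyadicStep _ _)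
      (hU.aemeasurable_dyadicStep _ _)
      (.of_forall fun x => dyadicStep_mono _ (fun k => ?_) _))
      (hU.norm_dyadicStep_average_le hs₀ X (measurable_gradModulus hf.continuous)
        (gradModulus_le hf) (A := A) (fun i j hij => ?_) (fun k => ?_) fun k => ?_)
    · exact mul_le_mul_right (isoProfile_mul_le_lintegral hI hμ hs2 hf hf0 (hV0 k) (hσ _)
        (hV2 k)) _
    · exact (hVmono.pairwise_disjoint_on_Ioo_succ hij).preimage f
    · exact hf.continuous.measurable measurableSet_Ioo
    · exact measure_between_le hf.continuous.measurable (hσ _) (hV1 k) (hV2 k)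
  -- Telescoping the drops `d` from `v 0 = 0`; each interval contributes at least half of its drop.
  have hb : ∀ k, v (k + 1) / 2 ≤ ∫⁻ s in Ico (s₀ / 2 ^ (k + 1)) s₀,
      dyadicStep s₀ a s / isoProfile μ (ENNReal.ofReal s) := by
    intro k
    induction k with
    | zero =>
      have := half_le_setLIntegral_dyadic hI hμ hs2 hs₀ hI0 d 0
      rw [pow_zero, div_one] at this
      refine le_trans (Eq.le ?_) this
      simp only [d, V, hv0, ENNReal.toReal_zero, sub_zero]
      rw [ENNReal.ofReal_toReal (hvt _)]
    | succ k ih =>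
      have hk : s₀ / 2 ^ (k + 1) ≤ s₀ := by
        simpa using dyadic_antitone hs₀.le (Nat.zero_le (k + 1))
      rw [← Ico_union_Ico_eq_Ico (dyadic_antitone hs₀.le (Nat.le_succ (k + 1))) hk,
        lintegral_union measurableSet_Ico (disjoint_left.2 fun s h1 h2 => not_lt.2 h2.1 h1.2)]
      refine le_trans (Eq.le ?_)
        (add_le_add (half_le_setLIntegral_dyadic hI hμ hs2 hs₀ hI0 d (k + 1)) ih)
      rw [← ENNReal.add_div, hvV (k + 1), ← ENNReal.ofReal_add
        (sub_nonneg.2 (hVmono (Nat.le_succ _))) (hV0 _), sub_add_cancel, ← hvV]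
  have hmain := hU.norm_dyadicStep_le_of_hardy hs₀ hI hμ hs2 X hK a (fun k => v (k + 1) / 2) hb
  have h2 : ∀ s, dyadicStep s₀ (fun k => v (k + 1) *
      (isoProfile μ (ENNReal.ofReal (s₀ / 2 ^ (k + 1))) / ENNReal.ofReal (s₀ / 2 ^ (k + 1)))) s =
      (2 : ℝ≥0) * dyadicStep s₀ (fun k => v (k + 1) / 2 *
      (isoProfile μ (ENNReal.ofReal (s₀ / 2 ^ (k + 1))) / ENNReal.ofReal (s₀ / 2 ^ (k + 1)))) s := by
    intro s
    rw [← dyadicStep_const_mul]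
    congr 1
    funext k
    rw [← mul_assoc, ENNReal.coe_ofNat, ENNReal.mul_div_cancel two_ne_zero ENNReal.ofNat_ne_top]
  calc _ = X.norm (fun x => (2 : ℝ≥0) * dyadicStep s₀ (fun k => v (k + 1) / 2 *
      (isoProfile μ (ENNReal.ofReal (s₀ / 2 ^ (k + 1))) /
        ENNReal.ofReal (s₀ / 2 ^ (k + 1)))) (U x)) := congrArg X.norm (funext fun x => h2 (U x))
    _ ≤ 2 * (2 * K * X.norm (gradModulus f)) := by
      rw [hU.norm_const_mul_dyadicStep X,
        ENNReal.coe_ofNat]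
      gcongr
      exact hmain.trans (by gcongr)
    _ = _ := by ring

end Core

/-! ### Existence of medians. -/

section Medians

theorem measure_lt_decRearr_le {α : Type*} [MeasurableSpace α] {μ : Measure α} {F : α → ℝ≥0∞}
    (hF : Measurable F) {s : ℝ} (hμ : μ univ = ENNReal.ofReal s + ENNReal.ofReal s) :
    μ {x | F x < decRearr μ F s} ≤ ENNReal.ofReal s := by
  rcases eq_or_ne (decRearr μ F s) 0 with h0 | h0
  · simp [h0]
  obtain ⟨t, htm, ht, hlim⟩ := exists_seq_strictMono_tendsto' (pos_iff_ne_zero.2 h0)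
  have hun : {x | F x < decRearr μ F s} ⊆ ⋃ n, {x | F x ≤ t n} := by
    intro x hx
    obtain ⟨n, hn⟩ := ((tendsto_order.1 hlim).1 _ hx).exists
    exact mem_iUnion.2 ⟨n, hn.le⟩
  have hmono : Monotone fun n => {x | F x ≤ t n} := fun m n hmn x hx =>
    le_trans hx (htm.monotone hmn)
  refine (measure_mono hun).trans ?_
  rw [hmono.measure_iUnion]
  refine iSup_le fun n => ?_
  have h1 := (lt_decRearr_iff.1 (ht n).2).le
  have hm : MeasurableSet {x | t n < F x} := measurableSet_lt measurable_const hF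
  have heq : {x | F x ≤ t n} = {x | t n < F x}ᶜ := by ext x; simp
  rw [heq, measure_compl hm (ne_top_of_le_ne_top (by simp [hμ]) (measure_mono (subset_univ _))), hμ]
  exact tsub_le_iff_right.2 (by gcongr)

/-- After a shift by `B` that makes `f` non-negative, the rearrangement at half the total mass is a
median. -/
theorem exists_median {α : Type*} [MeasurableSpace α] {μ : Measure α} {f : α → ℝ}
    (hf : Measurable f) {B : ℝ} (hB : ∀ x, |f x| ≤ B) {s : ℝ}
    (hμ : μ univ = ENNReal.ofReal s + ENNReal.ofReal s) :
    ∃ m : ℝ, μ {x | m < f x} ≤ ENNReal.ofReal s ∧ μ {x | f x < m} ≤ ENNReal.ofReal s := by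
  let F : α → ℝ≥0∞ := fun x => ENNReal.ofReal (f x + B)
  have hF : Measurable F := (hf.add_const B).ennreal_ofReal
  have h0 : ∀ x, 0 ≤ f x + B := fun x => by linarith [(abs_le.1 (hB x)).1]
  have hv : decRearr μ F s ≠ ∞ := by
    refine ne_top_of_le_ne_top (b := ENNReal.ofReal (2 * B)) ENNReal.ofReal_ne_top
      (decRearr_le_iff.2 ?_)
    have : {x | ENNReal.ofReal (2 * B) < F x} = ∅ := by
      ext x
      simp only [mem_ofPred_eq, mem_empty_iff_false, iff_false, not_lt]
      exact ENNReal.ofReal_le_ofReal (by linarith [(abs_le.1 (hB x)).2])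
    rw [this, measure_empty]
    exact zero_le
  refine ⟨(decRearr μ F s).toReal - B, ?_, ?_⟩
  · refine (measure_mono fun x hx => ?_).trans (decRearr_le_iff.1 (le_refl (decRearr μ F s)))
    have hx : (decRearr μ F s).toReal - B < f x := hx
    exact (ENNReal.lt_ofReal_iff_toReal_lt hv).2 (by linarith)
  · refine (measure_mono fun x hx => ?_).trans (measure_lt_decRearr_le hF hμ)
    have hx : f x < (decRearr μ F s).toReal - B := hx
    exact (ENNReal.ofReal_lt_iff_lt_toReal (h0 x) hv).2 (by linarith)

end Medians

/-- Where `w > r`, one has `1 ≤ r^(-α) w^α`. -/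
theorem norm_le_add_weight {Ω : Type*} [MeasurableSpace Ω] {μ : Measure Ω} (X : RISpace μ)
    {w f : Ω → ℝ} (hw : AEMeasurable w μ)
    (hf : Measurable f) {α r : ℝ} (hα : 0 < α) (hr : 0 < r) :
    X.normReal f ≤ X.norm ({x | w x ≤ r}.indicator fun x => ENNReal.ofReal |f x|) +
      ENNReal.ofReal (r ^ (-α)) * X.normReal (fun x => w x ^ α * f x) := by
  have hW : NullMeasurableSet {x | w x ≤ r} μ := nullMeasurableSet_le hw aemeasurable_const
  have hfa : AEMeasurable (fun x => ENNReal.ofReal |f x|) μ := by fun_prop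
  have hwf : AEMeasurable (fun x => ENNReal.ofReal |w x ^ α * f x|) μ := by
    have : AEMeasurable (fun x => w x ^ α * f x) μ := (hw.pow_const α).mul hf.aemeasurable
    fun_prop
  have hsm := X.norm_smul (Real.toNNReal (r ^ (-α))) _ hwf
  change _ = ENNReal.ofReal (r ^ (-α)) * X.normReal (fun x => w x ^ α * f x) at hsm
  rw [← hsm]
  refine le_trans (X.norm_mono _ _ hfa ((hfa.indicator₀ hW).add (hwf.const_mul _))
    (.of_forall fun x => ?_)) (X.norm_add_le _ _ (hfa.indicator₀ hW) (hwf.const_mul _))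
  change _ ≤ {x | w x ≤ r}.indicator (fun x => ENNReal.ofReal |f x|) x +
    ENNReal.ofReal (r ^ (-α)) * ENNReal.ofReal |w x ^ α * f x|
  by_cases hx : x ∈ {x | w x ≤ r}
  · rw [indicator_of_mem hx]
    exact le_self_add
  · rw [indicator_of_notMem hx, zero_add]
    have hwx : r < w x := not_le.1 hx
    rw [← ENNReal.ofReal_mul (by positivity)]
    refine ENNReal.ofReal_le_ofReal ?_
    have h1 : r ^ α ≤ w x ^ α := Real.rpow_le_rpow hr.le hwx.le hα.le
    have h2 : 0 < r ^ α := Real.rpow_pos_of_pos hr α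
    rw [abs_mul, abs_of_nonneg (h2.le.trans h1), Real.rpow_neg hr.le, ← mul_assoc]
    refine le_mul_of_one_le_left (abs_nonneg _) ?_
    rw [inv_mul_eq_div]
    exact (one_le_div h2).2 h1

/-! ### The local estimate for each admissible class of functions. -/

section Localization

variable {Ω : Type*} [MetricSpace Ω]

theorem gradModulus_neg (f : Ω → ℝ) : gradModulus (fun x => -f x) = gradModulus f := by
  funext x
  simp only [gradModulus]
  congr 1
  funext y
  rw [← abs_neg]
  congr 3
  ring

theorem gradModulus_sub_const (f : Ω → ℝ) (m : ℝ) :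
    gradModulus (fun x => f x - m) = gradModulus f := by
  funext x
  simp only [gradModulus, sub_sub_sub_cancel_right]

variable [MeasurableSpace Ω] {μ : Measure Ω} {s₀ : ℝ} {U : Ω → ℝ}

/-- Applying `Q̃` to the indicator of `[s₀/2, s₀)` shows that a dyadic version of `I(t)/t` has
finite norm. It dominates `1 / Λ` below `μ W`. This handles the constant subtracted when the mean is
zero. -/
theorem IsUniform.exists_norm_indicator_one_le (hU : IsUniform μ s₀ U) (hs₀ : 0 < s₀)
    (hI : AdmissibleProfile μ) (hμ : μ univ ≠ 0) (hs2 : ENNReal.ofReal s₀ = μ univ / 2)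
    (hI0 : ∀ t, 0 < t → ENNReal.ofReal t ≤ μ univ / 2 → isoProfile μ (ENNReal.ofReal t) ≠ 0)
    (X : RISpace μ) {K : ℝ≥0} (hK : ∀ h : ℝ → ℝ≥0∞, AEMeasurable h (lebesgueOn (μ univ)) →
      X.barNorm (isoHardy μ h) ≤ K * X.barNorm h) :
    ∃ N : ℝ≥0, ∀ W : Set Ω, NullMeasurableSet W μ → ∀ Λ : ℝ≥0, isoPhi μ (μ W) ≤ Λ →
      X.norm (W.indicator fun _ => 1) ≤ Λ * N := by
  have hlt := ofReal_lt_measure_univ_of_le_half hμ hs2.le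
  have hIf := (hI.finite s₀ ⟨hs₀.le, hlt⟩).ne
  have hIz := hI0 s₀ hs₀ hs2.le
  set β : ℝ≥0∞ := ENNReal.ofReal (s₀ / 2) / isoProfile μ (ENNReal.ofReal s₀) with hβ
  have hβ0 : β ≠ 0 := (ENNReal.div_pos (by simpa using hs₀) hIf).ne'
  have hβt : β ≠ ∞ := ENNReal.div_ne_top ENNReal.ofReal_ne_top hIz
  let J : ℕ → ℝ≥0∞ := fun k => isoProfile μ (ENNReal.ofReal (s₀ / 2 ^ (k + 1))) /
    ENNReal.ofReal (s₀ / 2 ^ (k + 1))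
  let a : ℕ → ℝ≥0∞ := fun k => if k = 0 then 1 else 0
  have ha : ∀ s ∈ Ico (s₀ / 2) s₀, dyadicStep s₀ a s = 1 := fun s hs => by
    rw [dyadicStep_of_mem hs₀.le a (k := 0) (by simpa using hs)]; simp [a]
  have hb : ∀ k : ℕ, β ≤ ∫⁻ s in Ico (s₀ / 2 ^ (k + 1)) s₀,
      dyadicStep s₀ a s / isoProfile μ (ENNReal.ofReal s) := by
    intro k
    calc β = ∫⁻ s in Ico (s₀ / 2) s₀, 1 / isoProfile μ (ENNReal.ofReal s₀) := by
          rw [setLIntegral_const, Real.volume_Ico, hβ, one_div, ENNReal.div_eq_inv_mul]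
          congr 2; ring
      _ ≤ ∫⁻ s in Ico (s₀ / 2) s₀, dyadicStep s₀ a s / isoProfile μ (ENNReal.ofReal s) := by
          refine setLIntegral_mono' measurableSet_Ico fun s hs => ?_
          rw [ha s hs]
          exact ENNReal.div_le_div_left (hI.mono hμ (by linarith [hs.1]) hs.2.le hs2.le) _
      _ ≤ _ := by
          refine lintegral_mono_set (Ico_subset_Ico_left ?_)
          simpa using dyadic_antitone hs₀.le (Nat.le_add_left 1 k)
  have h1 := hU.norm_dyadicStep_le_of_hardy hs₀ hI hμ hs2.le X hK a (fun _ => β) hb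
  have h2 : X.norm (fun x => dyadicStep s₀ a (U x)) < ∞ := by
    have hm : MeasurableSet (U ⁻¹' Ico (s₀ / 2) s₀) := hU.measurable measurableSet_Ico
    refine lt_of_eq_of_lt (congrArg X.norm (funext fun x => ?_)) (X.norm_indicator_lt_top
      (U ⁻¹' Ico (s₀ / 2) s₀) hm (by
        rw [hU.measure_Ico (by positivity) (by linarith) le_rfl]; exact ENNReal.ofReal_lt_top))
    by_cases hx : U x ∈ Ico (s₀ / 2) s₀
    · rw [ha _ hx, indicator_of_mem (show x ∈ U ⁻¹' Ico (s₀ / 2) s₀ from hx)]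
    · rw [indicator_of_notMem (show x ∉ U ⁻¹' Ico (s₀ / 2) s₀ from hx)]
      refine ENNReal.tsum_eq_zero.2 fun k => ?_
      rcases Nat.eq_zero_or_pos k with rfl | hk
      · exact indicator_of_notMem (by simpa using hx) _
      · simp [a, hk.ne']
  have h3 : X.norm (fun x => dyadicStep s₀ J (U x)) ≠ ∞ := by
    intro htop
    simp only [dyadicStep_const_mul] at h1
    have h4 := hU.norm_const_mul_dyadicStep X β.toNNReal s₀ J
    rw [ENNReal.coe_toNNReal hβt, htop, ENNReal.mul_top hβ0] at h4
    rw [h4, top_le_iff] at h1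
    exact ENNReal.mul_ne_top (ENNReal.mul_ne_top ENNReal.ofNat_ne_top ENNReal.coe_ne_top) h2.ne h1
  refine ⟨2 * (X.norm (fun x => dyadicStep s₀ J (U x))).toNNReal, fun W hW Λ hΛ => ?_⟩
  have hm : MeasurableSet {x | U x < s₀} := measurableSet_lt hU.measurable measurable_const
  have hμ1 : μ {x | U x < s₀} = ENNReal.ofReal s₀ := hU.measure_lt s₀ hs₀.le le_rfl
  have hμ2 : μ {x | U x < s₀}ᶜ = ENNReal.ofReal s₀ := by
    rw [measure_compl hm (by simp [hμ1]), hμ1, ← ENNReal.add_halves (μ univ), ← hs2]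
    exact ENNReal.add_sub_cancel_right ENNReal.ofReal_ne_top
  -- Localization requires supports of measure at most `s₀`, so `Ω` is cut into two halves.
  have hpart : ∀ S : Set Ω, MeasurableSet S → μ S = ENNReal.ofReal s₀ →
      X.norm (W.indicator (S.indicator fun _ => 1)) ≤
        Λ * X.norm (fun x => dyadicStep s₀ J (U x)) := by
    intro S hS hSμ
    have h := hU.norm_indicator_le hs₀ hI hμ hs2.le hI0 X
      (u := S.indicator fun _ => 1) (aemeasurable_const.indicator hS) hW
      (by
        rw [← hSμ]
        refine measure_mono fun x hx => ?_
        by_contra h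
        simp [h] at hx) hΛ (v := fun _ => 1) (fun k => decRearr_le_iff.2 (by
          have : {x | (1 : ℝ≥0∞) < S.indicator (fun _ => 1) x} = ∅ := by
            ext x; by_cases hx : x ∈ S <;> simp [hx]
          simp [this]))
    simpa only [one_mul] using h
  have hsplit : (W.indicator fun _ => (1 : ℝ≥0∞)) = fun x =>
      W.indicator ({x | U x < s₀}.indicator fun _ => 1) x +
        W.indicator ({x | U x < s₀}ᶜ.indicator fun _ => 1) x := by
    funext x
    by_cases hx : x ∈ W <;> by_cases hx' : U x < s₀ <;> simp [hx, hx']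
  rw [hsplit]
  refine (X.norm_add_le _ _ ((aemeasurable_const.indicator hm).indicator₀ hW)
    ((aemeasurable_const.indicator hm.compl).indicator₀ hW)).trans
    ((add_le_add (hpart _ hm hμ1) (hpart _ hm.compl hμ2)).trans (Eq.le ?_))
  rw [ENNReal.coe_mul, ENNReal.coe_toNNReal h3, ENNReal.coe_ofNat]
  ring

variable [BorelSpace Ω] [SigmaFinite μ]

/-- The one-sided estimate for `f` and `-f`, at `4 * K` each. It sees only positive values, so no
truncation is needed. -/
theorem IsUniform.norm_indicator_abs_le (hU : IsUniform μ s₀ U) (hs₀ : 0 < s₀)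
    (hI : AdmissibleProfile μ) (hμ : μ univ ≠ 0) (hs2 : ENNReal.ofReal s₀ ≤ μ univ / 2)
    (hI0 : ∀ t, 0 < t → ENNReal.ofReal t ≤ μ univ / 2 → isoProfile μ (ENNReal.ofReal t) ≠ 0)
    (X : RISpace μ) {K : ℝ≥0} (hK : ∀ h : ℝ → ℝ≥0∞, AEMeasurable h (lebesgueOn (μ univ)) →
      X.barNorm (isoHardy μ h) ≤ K * X.barNorm h) {W : Set Ω} (hW : NullMeasurableSet W μ)
    {Λ : ℝ≥0} (hΛ : isoPhi μ (μ W) ≤ Λ) {f : Ω → ℝ} {L : ℝ≥0} (hf : LipschitzWith L f) {B : ℝ}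
    (hB : ∀ x, |f x| ≤ B) (hf1 : μ {x | 0 < f x} ≤ ENNReal.ofReal s₀)
    (hf2 : μ {x | f x < 0} ≤ ENNReal.ofReal s₀) :
    X.norm (W.indicator fun x => ENNReal.ofReal |f x|) ≤ Λ * (8 * K) * X.norm (gradModulus f) := by
  have hone : ∀ g : Ω → ℝ, LipschitzWith L g → (∀ x, g x ≤ B) →
      μ {x | 0 < g x} ≤ ENNReal.ofReal s₀ →
      X.norm (W.indicator fun x => ENNReal.ofReal (g x)) ≤
        Λ * (4 * K * X.norm (gradModulus g)) := fun g hg hgB hg0 =>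
    (hU.norm_indicator_le hs₀ hI hμ hs2 hI0 X hg.continuous.measurable.ennreal_ofReal.aemeasurable
      hW (by simpa using hg0) hΛ fun k => le_rfl).trans (mul_le_mul_right
        (hU.norm_rearrangement_le_gradModulus hs₀ hI hμ hs2 hI0 X hK hg hgB hg0) _)
  have h1 := hone f hf (fun x => (le_abs_self _).trans (hB x)) hf1
  have h2 := hone (fun x => -f x) hf.neg (fun x => (neg_le_abs _).trans (hB x)) (by simpa using hf2)
  rw [gradModulus_neg] at h2
  have hsplit : (W.indicator fun x => ENNReal.ofReal |f x|) = fun x =>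
      W.indicator (fun x => ENNReal.ofReal (f x)) x +
        W.indicator (fun x => ENNReal.ofReal (-f x)) x := by
    funext x
    by_cases hx : x ∈ W
    · simp only [indicator_of_mem hx]
      rcases le_total 0 (f x) with h | h
      · rw [abs_of_nonneg h, ENNReal.ofReal_of_nonpos (neg_nonpos.2 h), add_zero]
      · rw [abs_of_nonpos h, ENNReal.ofReal_of_nonpos h, zero_add]
    · simp [hx]
  have hm : Measurable f := hf.continuous.measurable
  rw [hsplit]
  refine (X.norm_add_le _ _ (hm.ennreal_ofReal.aemeasurable.indicator₀ hW)
    (hm.neg.ennreal_ofReal.aemeasurable.indicator₀ hW)).trans ((add_le_add h1 h2).trans (Eq.le ?_))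
  ring

theorem exists_norm_indicator_le_of_infinite (hI : AdmissibleProfile μ) (hres : IsResonant μ)
    [IsFiniteMeasureOnCompacts μ] (hμ : μ univ = ∞)
    (hI0 : ∀ t, 0 < t → ENNReal.ofReal t ≤ μ univ / 2 → isoProfile μ (ENNReal.ofReal t) ≠ 0)
    (X : RISpace μ) (hQ : IsoHardyBounded X) :
    ∃ Θ : ℝ≥0, ∀ W : Set Ω, NullMeasurableSet W μ → ∀ Λ : ℝ≥0, isoPhi μ (μ W) ≤ Λ →
      ∀ f : Ω → ℝ, (∃ L : ℝ≥0, LipschitzWith L f) → HasCompactSupport f →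
        X.norm (W.indicator fun x => ENNReal.ofReal |f x|) ≤ Λ * Θ * X.norm (gradModulus f) := by
  obtain ⟨K, hK⟩ := hQ
  refine ⟨8 * K, fun W hW Λ hΛ f ⟨L, hf⟩ hfc => ?_⟩
  obtain ⟨B, hB⟩ := hfc.exists_bound_of_continuous hf.continuous
  -- `s₀` and `U` depend on `f`, but the constant `8 * K` does not.
  set s₀ := (μ (tsupport f)).toReal + 1 with hs₀def
  have hs₀ : 0 < s₀ := by positivity
  have hfin : μ (tsupport f) ≠ ∞ := hfc.isCompact.measure_ne_top
  have hsupp : ∀ S ⊆ Function.support f, μ S ≤ ENNReal.ofReal s₀ := fun S hS => by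
    refine (measure_mono (hS.trans (subset_tsupport f))).trans ?_
    rw [← ENNReal.ofReal_toReal hfin]
    exact ENNReal.ofReal_le_ofReal (by linarith)
  obtain ⟨U, hU⟩ := exists_isUniform hI hres hs₀ (by rw [hμ]; exact ENNReal.ofReal_lt_top)
  have h := hU.norm_indicator_abs_le hs₀ hI (by simp [hμ])
    (by rw [hμ, ENNReal.top_div_of_ne_top ENNReal.ofNat_ne_top]; exact le_top) hI0 X hK hW hΛ hf
    (B := B) (fun x => by simpa using hB x)
    (hsupp _ fun x hx => ne_of_gt hx) (hsupp _ fun x hx => ne_of_lt hx)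
  simpa using h

theorem exists_norm_indicator_le_of_finite (hI : AdmissibleProfile μ) (hres : IsResonant μ)
    (hμ0 : μ univ ≠ 0) (hμ : μ univ < ∞)
    (hI0 : ∀ t, 0 < t → ENNReal.ofReal t ≤ μ univ / 2 → isoProfile μ (ENNReal.ofReal t) ≠ 0)
    (X : RISpace μ) (hQ : IsoHardyBounded X) :
    ∃ Θ : ℝ≥0, ∀ W : Set Ω, NullMeasurableSet W μ → ∀ Λ : ℝ≥0, isoPhi μ (μ W) ≤ Λ →
      ∀ f : Ω → ℝ, (∃ L : ℝ≥0, LipschitzWith L f) → (∃ M : ℝ, ∀ x, |f x| ≤ M) →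
        (IsMedian μ f 0 ∨ ∫ x, f x ∂μ = 0) →
        X.norm (W.indicator fun x => ENNReal.ofReal |f x|) ≤ Λ * Θ * X.norm (gradModulus f) := by
  have : IsFiniteMeasure μ := ⟨hμ⟩
  obtain ⟨K, hK⟩ := hQ
  set s₀ := (μ univ / 2).toReal with hs₀def
  have hhalf : μ univ / 2 ≠ ∞ := ENNReal.div_ne_top hμ.ne two_ne_zero
  have hs2 : ENNReal.ofReal s₀ = μ univ / 2 := ENNReal.ofReal_toReal hhalf
  have hs₀ : 0 < s₀ := ENNReal.toReal_pos (ENNReal.half_pos hμ0).ne' hhalf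
  have hlt := ofReal_lt_measure_univ_of_le_half hμ0 hs2.le
  have hdouble : μ univ = ENNReal.ofReal s₀ + ENNReal.ofReal s₀ := by
    rw [hs2, ENNReal.add_halves]
  obtain ⟨U, hU⟩ := exists_isUniform hI hres hs₀ hlt
  obtain ⟨N, hN⟩ := hU.exists_norm_indicator_one_le hs₀ hI hμ0 hs2 hI0 X hK
  obtain ⟨CX, hCX⟩ := X.lintegral_le univ MeasurableSet.univ hμ
  have hΦ : isoPhi μ (μ univ) ≠ ∞ := by
    rw [isoPhi, if_neg hμ.ne, min_eq_right ENNReal.half_le_self, ← hs2]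
    exact ENNReal.div_ne_top ENNReal.ofReal_ne_top (hI0 s₀ hs₀ hs2.le)
  set Λ₀ := (isoPhi μ (μ univ)).toNNReal with hΛ₀
  have hΛ₀e : isoPhi μ (μ univ) = Λ₀ := (ENNReal.coe_toNNReal hΦ).symm
  set M := (μ univ).toNNReal with hM
  have hMe : μ univ = M := (ENNReal.coe_toNNReal hμ.ne).symm
  have hM0 : M ≠ 0 := fun h => hμ0 (by rw [hMe, h, ENNReal.coe_zero])
  -- The first summand is the median case; the second bounds `|m|` times the norm of the indicator
  -- of `W`.
  refine ⟨8 * K + M⁻¹ * (CX * (Λ₀ * (8 * K))) * N, fun W hW Λ hΛ f ⟨L, hf⟩ ⟨B, hB⟩ hcase => ?_⟩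
  have hfm : Measurable f := hf.continuous.measurable
  have hΘ : Λ * ((8 * K + M⁻¹ * (CX * (Λ₀ * (8 * K))) * N : ℝ≥0) : ℝ≥0∞) *
      X.norm (gradModulus f) = Λ * (8 * K) * X.norm (gradModulus f) +
        (M : ℝ≥0∞)⁻¹ * (CX * (Λ₀ * (8 * K) * X.norm (gradModulus f))) * (Λ * N) := by
    push_cast [ENNReal.coe_inv hM0]
    ring
  rw [hΘ]
  rcases hcase with hmed | hint
  · refine le_add_right (hU.norm_indicator_abs_le hs₀ hI hμ0 hs2.le hI0 X hK hW hΛ hf hB ?_ ?_)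
    · have : {x | 0 < f x} = {x | f x ≤ 0}ᶜ := by ext x; simp
      rw [this, measure_compl (measurableSet_le hfm measurable_const) (measure_ne_top _ _)]
      refine tsub_le_iff_right.2 ?_
      rw [hdouble]
      gcongr
      rw [hs2]
      exact hmed.2
    · have : {x | f x < 0} = {x | 0 ≤ f x}ᶜ := by ext x; simp
      rw [this, measure_compl (measurableSet_le measurable_const hfm) (measure_ne_top _ _)]
      refine tsub_le_iff_right.2 ?_
      rw [hdouble]
      gcongr
      rw [hs2]
      exact hmed.1
  · obtain ⟨m, hm1, hm2⟩ := exists_median hfm hB hdouble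
    have hg : LipschitzWith L fun x => f x - m := fun x y => by
      simpa [edist_dist, Real.dist_eq] using hf x y
    have hgB : ∀ x, |f x - m| ≤ B + |m| := fun x => (abs_sub _ _).trans (by gcongr; exact hB x)
    have hbound := fun W hW Λ hΛ => hU.norm_indicator_abs_le hs₀ hI hμ0 hs2.le hI0 X hK
      (W := W) hW (Λ := Λ) hΛ hg hgB (by simpa using hm1) (by simpa using hm2)
    simp only [gradModulus_sub_const] at hbound
    -- Since `∫ f = 0`, `|m| μ(Ω) = |∫ (f - m)|`, which the estimate for `f - m` on `W = Ω`
    -- controls.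
    have hm : ENNReal.ofReal |m| * M ≤ CX * (Λ₀ * (8 * K) * X.norm (gradModulus f)) := by
      have hfi : Integrable f μ := Integrable.of_bound hfm.aestronglyMeasurable B
        (.of_forall fun x => by simpa using hB x)
      have hI1 : ∫ x, (f x - m) ∂μ = -(m * μ.real univ) := by
        rw [integral_sub hfi (integrable_const m), hint, integral_const, smul_eq_mul]; ring
      have hgm : AEMeasurable (fun x => ENNReal.ofReal |f x - m|) μ := by fun_prop
      calc ENNReal.ofReal |m| * M = ‖∫ x, (f x - m) ∂μ‖ₑ := by
            rw [hI1, enorm_neg, enorm_mul, Real.enorm_eq_ofReal_abs, Real.enorm_eq_ofReal_abs,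
              abs_of_nonneg measureReal_nonneg, ofReal_measureReal, hMe]
        _ ≤ ∫⁻ x, ‖f x - m‖ₑ ∂μ := enorm_integral_le_lintegral_enorm _
        _ = ∫⁻ x in univ, ENNReal.ofReal |f x - m| ∂μ := by
            simp only [Real.enorm_eq_ofReal_abs, Measure.restrict_univ]
        _ ≤ CX * X.norm (fun x => ENNReal.ofReal |f x - m|) := hCX _ hgm
        _ ≤ _ := by
            gcongr
            have := hbound univ MeasurableSet.univ.nullMeasurableSet Λ₀ hΛ₀e.le
            rwa [indicator_univ] at this
    have hm' : ENNReal.ofReal |m| ≤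
        (M : ℝ≥0∞)⁻¹ * (CX * (Λ₀ * (8 * K) * X.norm (gradModulus f))) := by
      rw [mul_comm, ← div_eq_mul_inv, ENNReal.le_div_iff_mul_le (Or.inl (by simpa using hM0))
        (Or.inl ENNReal.coe_ne_top)]
      exact hm
    have hgm : AEMeasurable (fun x => ENNReal.ofReal |f x - m|) μ := by fun_prop
    have hfa : AEMeasurable (fun x => ENNReal.ofReal |f x|) μ := by fun_prop
    have h1m : AEMeasurable (W.indicator fun _ => (1 : ℝ≥0∞)) μ := aemeasurable_const.indicator₀ hW
    calc X.norm (W.indicator fun x => ENNReal.ofReal |f x|)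
        ≤ X.norm (fun x => W.indicator (fun x => ENNReal.ofReal |f x - m|) x +
            (Real.toNNReal |m| : ℝ≥0) * W.indicator (fun _ => 1) x) := by
          refine X.norm_mono _ _ (hfa.indicator₀ hW)
            ((hgm.indicator₀ hW).add (h1m.const_mul _)) (.of_forall fun x => ?_)
          by_cases hx : x ∈ W
          · simp only [indicator_of_mem hx, mul_one]
            change _ ≤ _ + ENNReal.ofReal |m|
            rw [← ENNReal.ofReal_add (abs_nonneg _) (abs_nonneg _)]
            refine ENNReal.ofReal_le_ofReal ?_
            simpa using abs_add_le (f x - m) m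
          · simp [hx]
      _ ≤ X.norm (W.indicator fun x => ENNReal.ofReal |f x - m|) +
            ENNReal.ofReal |m| * X.norm (W.indicator fun _ => 1) := by
          refine (X.norm_add_le _ _ (hgm.indicator₀ hW) (h1m.const_mul _)).trans ?_
          rw [X.norm_smul _ _ h1m]
          rfl
      _ ≤ _ := add_le_add (hbound W hW Λ hΛ) (mul_le_mul' hm' (hN W hW Λ hΛ))

end Localization

end

/-! ### Conclusion. -/

theorem mainTheorem6 {Ω : Type*} [MetricSpace Ω] [ConnectedSpace Ω] [MeasurableSpace Ω]
    [BorelSpace Ω] (μ : Measure Ω) [SigmaFinite μ] [IsFiniteMeasureOnCompacts μ]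
    (hI : AdmissibleProfile μ) (hres : IsResonant μ)
    (X : RISpace μ) (hQ : IsoHardyBounded X)
    (w : Ω → ℝ) (hw : IsIsoperimetricWeight μ w) :
    ∃ C : ℝ, 0 < C ∧ ∀ α : ℝ, 0 < α → ∀ f : Ω → ℝ, (∃ L : ℝ≥0, LipschitzWith L f) →
      ((μ univ < ∞ ∧ (∃ M : ℝ, ∀ x, |f x| ≤ M) ∧ (IsMedian μ f 0 ∨ ∫ x, f x ∂μ = 0)) ∨
        (μ univ = ∞ ∧ HasCompactSupport f)) →
      ∀ r : ℝ, 0 < r →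
        X.normReal f ≤ ENNReal.ofReal (r * C) * X.norm (gradModulus f) +
          ENNReal.ofReal (r ^ (-α)) * X.normReal (fun x => w x ^ α * f x) := by
  rcases eq_or_ne (μ univ) 0 with hμ0 | hμ0
  · refine ⟨1, one_pos, fun α _ f ⟨L, hf⟩ _ r _ => le_trans (Eq.le ?_) zero_le⟩
    have hfm := hf.continuous.measurable
    have hae : (fun x => ENNReal.ofReal |f x|) =ᵐ[μ] 0 := by
      rw [Measure.measure_univ_eq_zero.1 hμ0, Filter.EventuallyEq, ae_zero]
      exact eventually_bot
    exact (X.norm_eq_zero_iff _ (by fun_prop)).2 hae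
  have hI0 := fun t ht ht2 => hI.ne_zero hμ0 hw (t := t) ht ht2
  obtain ⟨Cw, hCw, hgrowth⟩ := hw.growth
  obtain ⟨Θ, hΘ⟩ : ∃ Θ : ℝ≥0, ∀ W : Set Ω, NullMeasurableSet W μ → ∀ Λ : ℝ≥0,
      isoPhi μ (μ W) ≤ Λ → ∀ f : Ω → ℝ, (∃ L : ℝ≥0, LipschitzWith L f) →
      ((μ univ < ∞ ∧ (∃ M : ℝ, ∀ x, |f x| ≤ M) ∧ (IsMedian μ f 0 ∨ ∫ x, f x ∂μ = 0)) ∨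
        (μ univ = ∞ ∧ HasCompactSupport f)) →
      X.norm (W.indicator fun x => ENNReal.ofReal |f x|) ≤ Λ * Θ * X.norm (gradModulus f) := by
    rcases eq_or_ne (μ univ) ∞ with hμ | hμ
    · obtain ⟨Θ, h⟩ := exists_norm_indicator_le_of_infinite hI hres hμ hI0 X hQ
      exact ⟨Θ, fun W hW Λ hΛ f hf hc => h W hW Λ hΛ f hf
        (hc.resolve_left fun h' => h'.1.ne hμ).2⟩
    · obtain ⟨Θ, h⟩ := exists_norm_indicator_le_of_finite hI hres hμ0 hμ.lt_top hI0 X hQ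
      refine ⟨Θ, fun W hW Λ hΛ f hf hc => ?_⟩
      obtain ⟨-, hB, hc⟩ := hc.resolve_right fun h' => hμ h'.1
      exact h W hW Λ hΛ f hf hB hc
  -- The `+ 1` only keeps the constant positive when `Θ = 0`.
  refine ⟨Cw * Θ + 1, by positivity, fun α hα f hf hc r hr => ?_⟩
  obtain ⟨L, hL⟩ := id hf
  refine (norm_le_add_weight X hw.aemeasurable hL.continuous.measurable hα hr).trans
    (add_le_add_left ?_ _)
  refine (hΘ _ (nullMeasurableSet_le hw.aemeasurable aemeasurable_const)
    (Real.toNNReal (Cw * r)) (hgrowth r hr) f hf hc).trans ?_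
  gcongr
  change ENNReal.ofReal (Cw * r) * _ ≤ _
  rw [← ENNReal.ofReal_coe_nnreal, ← ENNReal.ofReal_mul (by positivity)]
  refine ENNReal.ofReal_le_ofReal ?_
  nlinarith
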